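/- Let $R$ be an associative ring with $1$; modules are left $R$-modules. Let $n\in\mathbb{N}\cup\{\infty\}$, with $\infty+1=\infty$. Let $\mathcal{P}^{<n+1}$ be the class of modules that have a finite resolution, of length $<n+1$, by finitely generated projective modules. A short exact sequence of modules is called $n$-exact (respectively pure exact) if it stays exact under $\mathrm{Hom}_R(M,-)$ for all $M\in\mathcal{P}^{<n+1}$ (respectively for all finitely presented $M$). A complex $X^\bullet$ is called $n$-exact (respectively pure exact) if for all $i\in\mathbb{Z}$ the sequence $0\to \mathrm{Ker}\, d^i\to X^i\to \mathrm{Coker}\, d^{i-1}\to 0$ is an $n$-exact (respectively pure exact) short exact sequence. For $\ast\in\{\text{blank},+,-,b\}$ let $\boldsymbol{K}^{\ast}(R)$ be the homotopy category of the complexes of modules that are arbitrary, bounded below, bounded above, or bounded, respectively. Let $\boldsymbol{K}^{\ast}_{n}(R)$ and $\boldsymbol{K}^{\ast}_{\mathcal{PE}}(R)$ be its full subcategories of $n$-exact and of pure exact complexes, so that $\boldsymbol{K}^{\ast}_{\mathcal{PE}}(R)\subseteq \boldsymbol{K}^{\ast}_{n}(R)$. Form the Verdier quotients $$\boldsymbol{D}^{\ast}_{n}(R)=\boldsymbol{K}^{\ast}(R)/\boldsymbol{K}^{\ast}_{n}(R),\qquad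 \boldsymbol{D}^{\ast}_{\mathbf{pur}}(R)=\boldsymbol{K}^{\ast}(R)/\boldsymbol{K}^{\ast}_{\mathcal{PE}}(R),\qquad \boldsymbol{K}^{\ast}_{n,\mathbf{pur}}(R)=\boldsymbol{K}^{\ast}_{n}(R)/\boldsymbol{K}^{\ast}_{\mathcal{PE}}(R).$$ The inclusion $\boldsymbol{K}^{\ast}_{n}(R)\subseteq\boldsymbol{K}^{\ast}(R)$ induces a fully faithful triangulated functor $\boldsymbol{K}^{\ast}_{n,\mathbf{pur}}(R)\to\boldsymbol{D}^{\ast}_{\mathbf{pur}}(R)$, through which $\boldsymbol{K}^{\ast}_{n,\mathbf{pur}}(R)$ is regarded as a triangulated subcategory, closed under isomorphisms, of $\boldsymbol{D}^{\ast}_{\mathbf{pur}}(R)$. Then for every $\ast\in\{\text{blank},+,-,b\}$ and every $n$ there is a triangulated equivalence $$\boldsymbol{D}^{\ast}_{\mathbf{pur}}(R)/\boldsymbol{K}^{\ast}_{n,\mathbf{pur}}(R)\;\cong\;\boldsymbol{D}^{\ast}_{n}(R),$$ compatible, up to natural isomorphism, with the quotient functor $\boldsymbol{D}^{\ast}_{\mathbf{pur}}(R)\to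 \boldsymbol{D}^{\ast}_{\mathbf{pur}}(R)/\boldsymbol{K}^{\ast}_{n,\mathbf{pur}}(R)$ and the canonical functor $\boldsymbol{D}^{\ast}_{\mathbf{pur}}(R)\to\boldsymbol{D}^{\ast}_{n}(R)$ induced by the identity of $\boldsymbol{K}^{\ast}(R)$. Furthermore, for every $\ast$ and every $n$, the following are equivalent: 1. $R$ is left coherent and every finitely presented $R$-module has projective dimension $<n+1$; 2. $\boldsymbol{K}^{\ast}_{n,\mathbf{pur}}(R)=0$; 3. $\boldsymbol{D}^{\ast}_{\mathbf{pur}}(R)$ is naturally equivalent to $\boldsymbol{D}^{\ast}_{n}(R)$ as a triangulated category, that is, the canonical functor $\boldsymbol{D}^{\ast}_{\mathbf{pur}}(R)\to\boldsymbol{D}^{\ast}_{n}(R)$ is a triangulated equivalence. Moreover, if $n\in\mathbb{N}$, these are also equivalent to: $R$ is left coherent and $\mathrm{w.gl.dim}(R)<n+1$, where $\mathrm{w.gl.dim}(R)$ is the supremum of the flat dimensions of all left $R$-modules. -/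

import Mathlib

open CategoryTheory Limits Pretriangulated Opposite
open scoped TensorProduct
universe u
namespace NDerived

/-- `HasResolution 𝒞 k M` means that there is an exact sequence
`0 ⟶ P_k ⟶ ⋯ ⟶ P_1 ⟶ P_0 ⟶ M ⟶ 0` with all `P_i` in `𝒞` (a class closed under isomorphisms).
The sequence is built by splicing short exact sequences `0 ⟶ K ⟶ P_0 ⟶ M ⟶ 0`, where `K` has
such a resolution of length one less. -/
inductive HasResolution {R : Type u} [Ring R] (𝒞 : ObjectProperty (ModuleCat.{u} R)) :
    ℕ → ModuleCat.{u} R → Prop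
  | zero {M : ModuleCat.{u} R} (hM : 𝒞 M) : HasResolution 𝒞 0 M
  | succ {k : ℕ} {K P M : ModuleCat.{u} R} (f : K ⟶ P) (g : P ⟶ M) (w : f ≫ g = 0)
      (hS : (ShortComplex.mk f g w).ShortExact) (hP : 𝒞 P) (hK : HasResolution 𝒞 k K) :
      HasResolution 𝒞 (k + 1) M

/-- The finitely generated projective left `R`-modules. -/
def fgProjective (R : Type u) [Ring R] : ObjectProperty (ModuleCat.{u} R) :=
  fun M => Module.Finite R M ∧ Module.Projective R M

/-- The class `𝒫^{< n+1}` of the modules with a finite resolution, of length less than `n + 1`,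
by finitely generated projective modules. Here `n` is a natural number or `∞`, and `∞ + 1 = ∞`. -/
def finResLTSucc (R : Type u) [Ring R] (n : ℕ∞) : ObjectProperty (ModuleCat.{u} R) :=
  fun M => ∃ k : ℕ, (k : ℕ∞) < n + 1 ∧ HasResolution (fgProjective R) k M

/-- The finitely presented left `R`-modules. -/
def finPresented (R : Type u) [Ring R] : ObjectProperty (ModuleCat.{u} R) :=
  fun M => Module.FinitePresentation R M

/-- A short exact sequence `0 ⟶ A ⟶ B ⟶ C ⟶ 0` of `R`-modules such that
`0 ⟶ Hom(M, A) ⟶ Hom(M, B) ⟶ Hom(M, C) ⟶ 0` is exact for all `M` in `𝒞`. For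
`𝒞 = finResLTSucc R n` this is an `n`-exact sequence, for `𝒞 = finPresented R` a pure exact
sequence. -/
def RelShortExact {R : Type u} [Ring R] (𝒞 : ObjectProperty (ModuleCat.{u} R))
    (S : ShortComplex (ModuleCat.{u} R)) : Prop :=
  S.ShortExact ∧ ∀ M : ModuleCat.{u} R, 𝒞 M →
    (S.map (preadditiveCoyoneda.obj (op M))).ShortExact

/-- The sequence `0 ⟶ Ker d^i ⟶ X^i ⟶ Coker d^{i-1} ⟶ 0` is short exact relative to `𝒞`.
That `Ker d^i ⟶ X^i ⟶ Coker d^{i-1}` vanishes is a part of the condition. -/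
def RelExactAt {R : Type u} [Ring R] (𝒞 : ObjectProperty (ModuleCat.{u} R))
    (X : CochainComplex (ModuleCat.{u} R) ℤ) (i : ℤ) : Prop :=
  ∃ w : X.iCycles i ≫ X.pOpcycles i = 0,
    RelShortExact 𝒞 (ShortComplex.mk (X.iCycles i) (X.pOpcycles i) w)

lemma relShortExact_iff {R : Type u} [Ring R] (𝒞 : ObjectProperty (ModuleCat.{u} R))
    (S : ShortComplex (ModuleCat.{u} R)) :
    RelShortExact 𝒞 S ↔ S.ShortExact ∧ ∀ M : ModuleCat.{u} R, 𝒞 M →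
      ∀ f : M ⟶ S.X₃, ∃ g : M ⟶ S.X₂, g ≫ S.g = f := by
  refine and_congr_right fun hS => forall₂_congr fun M _ => ⟨fun h f => ?_, fun h => ?_⟩
  · exact (AddCommGrpCat.epi_iff_surjective _).1 h.epi_g f
  · have := hS.mono_f
    refine { exact := ?_, mono_f := ?_, epi_g := ?_ }
    · rw [ShortComplex.ab_exact_iff]
      intro (x : M ⟶ S.X₂) (hx : x ≫ S.g = 0)
      exact ⟨hS.exact.lift x hx, hS.exact.lift_f x hx⟩
    · rw [AddCommGrpCat.mono_iff_injective]
      intro (x : M ⟶ S.X₁) (y : M ⟶ S.X₁) (hxy : x ≫ S.f = y ≫ S.f)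
      exact (cancel_mono S.f).1 hxy
    · rw [AddCommGrpCat.epi_iff_surjective]
      exact h


lemma exactAt_of_relExactAt {R : Type u} [Ring R] {𝒞 : ObjectProperty (ModuleCat.{u} R)}
    {X : CochainComplex (ModuleCat.{u} R) ℤ} {i : ℤ} (h : RelExactAt 𝒞 X i) : X.ExactAt i := by
  obtain ⟨w, -⟩ := h
  rw [HomologicalComplex.exactAt_iff, ShortComplex.exact_iff_iCycles_pOpcycles_zero]
  exact w

lemma mono_fromOpcycles {R : Type u} [Ring R] {X : CochainComplex (ModuleCat.{u} R) ℤ}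
    {i : ℤ} (h : X.ExactAt i) (j : ℤ) (hij : i + 1 = j) : Mono (X.fromOpcycles i j) := by
  obtain rfl : j = (ComplexShape.up ℤ).next i := by simp [← hij]
  exact ((ShortComplex.exact_iff_mono_fromOpcycles _).1 h)

lemma exact_fromOpcycles {R : Type u} [Ring R] {X : CochainComplex (ModuleCat.{u} R) ℤ}
    (i j k : ℤ) (hij : i + 1 = j) (hjk : j + 1 = k) (h : X.ExactAt j) :
    (ShortComplex.mk (X.fromOpcycles i j) (X.d j k) (by simp)).Exact := by
  rw [HomologicalComplex.exactAt_iff' X i j k (by simp [← hij]) (by simp [← hjk])] at h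
  let φ : X.sc' i j k ⟶ ShortComplex.mk (X.fromOpcycles i j) (X.d j k) (by simp) :=
    { τ₁ := X.pOpcycles i
      τ₂ := 𝟙 (X.X j)
      τ₃ := 𝟙 (X.X k)
      comm₁₂ := (X.p_fromOpcycles i j).trans (Category.comp_id _).symm
      comm₂₃ := (Category.id_comp _).trans (Category.comp_id _).symm }
  have h1 : Epi φ.τ₁ := inferInstanceAs (Epi (X.pOpcycles i))
  have h2 : IsIso φ.τ₂ := inferInstanceAs (IsIso (𝟙 (X.X j)))
  have h3 : Mono φ.τ₃ := inferInstanceAs (Mono (𝟙 (X.X k)))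
  exact (ShortComplex.exact_iff_of_epi_of_isIso_of_mono φ).1 h

/-- Relative exactness, expressed by lifting of cocycles. -/
lemma relExactAt_iff {R : Type u} [Ring R] (𝒞 : ObjectProperty (ModuleCat.{u} R))
    (h𝒞 : 𝒞 (ModuleCat.of R R)) (X : CochainComplex (ModuleCat.{u} R) ℤ) :
    (∀ i, RelExactAt 𝒞 X i) ↔
      ∀ (P : ModuleCat.{u} R), 𝒞 P → ∀ (i j k : ℤ), i + 1 = j → j + 1 = k →
        ∀ f : P ⟶ X.X j, f ≫ X.d j k = 0 → ∃ g : P ⟶ X.X i, g ≫ X.d i j = f := by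
  constructor
  · intro h P hP i j k hij hjk f hf
    have hj := exactAt_of_relExactAt (h j)
    have := mono_fromOpcycles (exactAt_of_relExactAt (h i)) j hij
    have hex := exact_fromOpcycles i j k hij hjk hj
    obtain ⟨w, hi⟩ := h i
    obtain ⟨g, hg⟩ := ((relShortExact_iff _ _).1 hi).2 P hP (hex.lift f hf)
    refine ⟨g, ?_⟩
    have h1 := hex.lift_f f hf
    dsimp at hg h1
    rw [← h1, ← hg, Category.assoc, HomologicalComplex.p_fromOpcycles]
  · intro h
    have hex : ∀ i, X.ExactAt i := fun i => by
      rw [HomologicalComplex.exactAt_iff' X (i - 1) i (i + 1) (by simp) (by simp),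
        ShortComplex.moduleCat_exact_iff]
      intro x hx
      obtain ⟨g, hg⟩ := h (ModuleCat.of R R) h𝒞 (i - 1) i (i + 1) (by simp) rfl
        (ModuleCat.ofHom (LinearMap.toSpanSingleton R (X.X i) x)) (by
          ext
          exact (congr_arg (X.d i (i + 1)).hom (one_smul R x)).trans hx)
      refine ⟨g.hom (1 : R), ?_⟩
      exact (congr_arg (fun φ => φ.hom (1 : R)) hg).trans (one_smul R x)
    intro i
    have w : X.iCycles i ≫ X.pOpcycles i = 0 := by
      have := hex i
      rw [HomologicalComplex.exactAt_iff, ShortComplex.exact_iff_iCycles_pOpcycles_zero] at this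
      exact this
    refine ⟨w, (relShortExact_iff _ _).2 ⟨?_, ?_⟩⟩
    · refine { exact := ?_, mono_f := ?_, epi_g := ?_ }
      · refine ShortComplex.exact_of_f_is_kernel _ ?_
        have := mono_fromOpcycles (hex i) (i + 1) rfl
        refine Fork.IsLimit.mk _
          (fun s => X.liftCycles s.ι (i + 1) (by simp) (by
            rw [← X.p_fromOpcycles i (i + 1), ← Category.assoc, s.condition]
            simp)) (fun s => by simp) (fun s m hm => by
            rw [← cancel_mono (X.iCycles i)]
            simpa using hm)
      · dsimp; infer_instance
      · dsimp; infer_instance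
    · intro P hP f
      have := mono_fromOpcycles (hex i) (i + 1) rfl
      obtain ⟨g, hg⟩ := h P hP i (i + 1) (i + 2) rfl (by ring)
        (f ≫ X.fromOpcycles i (i + 1)) (by simp)
      refine ⟨g, ?_⟩
      dsimp
      rw [← cancel_mono (X.fromOpcycles i (i + 1)), Category.assoc,
        HomologicalComplex.p_fromOpcycles, hg]

/-- The objects `X` of the homotopy category `K(R)` such that the complex `X` is exact relative
to `𝒞` in all degrees. -/
def relExact {R : Type u} [Ring R] (𝒞 : ObjectProperty (ModuleCat.{u} R)) :
    ObjectProperty (HomotopyCategory (ModuleCat.{u} R) (ComplexShape.up ℤ)) :=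
  fun X => ∀ i : ℤ, RelExactAt 𝒞 X.as i

/-- The complexes isomorphic, in `K(R)`, to a module of `𝒞` placed in a single degree. -/
def stalks {R : Type u} [Ring R] (𝒞 : ObjectProperty (ModuleCat.{u} R)) :
    ObjectProperty (HomotopyCategory (ModuleCat.{u} R) (ComplexShape.up ℤ)) :=
  fun Y => ∃ (P : ModuleCat.{u} R) (i : ℤ), 𝒞 P ∧
    Nonempty (Y ≅ (HomotopyCategory.singleFunctor _ i).obj P)

instance {R : Type u} [Ring R] (𝒞 : ObjectProperty (ModuleCat.{u} R)) :
    (stalks 𝒞).IsStableUnderShift ℤ where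
  isStableUnderShiftBy n :=
    { le_shift := by
        rintro Y ⟨P, i, hP, ⟨e⟩⟩
        exact ⟨P, i - n, hP, ⟨(shiftFunctor _ n).mapIso e ≪≫
          ((HomotopyCategory.singleFunctors (ModuleCat.{u} R)).shiftIso n (i - n) i
            (by ring)).app P⟩⟩ }

open CochainComplex.HomComplex in
lemma relExact_eq {R : Type u} [Ring R] (𝒞 : ObjectProperty (ModuleCat.{u} R))
    (h𝒞 : 𝒞 (ModuleCat.of R R)) : relExact 𝒞 = (stalks 𝒞).rightOrthogonal := by
  ext X
  obtain ⟨K : CochainComplex _ _, rfl⟩ := X.quotient_obj_surjective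
  change (∀ i, RelExactAt 𝒞 K i) ↔ _
  rw [relExactAt_iff 𝒞 h𝒞]
  have key : ∀ (P : ModuleCat.{u} R) (i j k : ℤ), i + 1 = j → j + 1 = k →
      ((∀ f : P ⟶ K.X j, f ≫ K.d j k = 0 → ∃ g : P ⟶ K.X i, g ≫ K.d i j = f) ↔
        ∀ φ : (HomotopyCategory.singleFunctor _ j).obj P ⟶
          (HomotopyCategory.quotient _ _).obj (K⟦(0 : ℤ)⟧), φ = 0) := by
    intro P i j k hij hjk
    constructor
    · intro h φ
      obtain ⟨x, rfl⟩ := (CohomologyClass.toHom_bijective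
        ((CochainComplex.singleFunctor _ j).obj P) K 0).2 φ
      obtain ⟨x, rfl⟩ := x.mk_surjective
      obtain ⟨f, hf, rfl⟩ := Cocycle.fromSingleMk_surjective x j (by simp) k hjk
      exact (CohomologyClass.toHom_mk_eq_zero_iff _).2
        ((Cocycle.fromSingleMk_mem_coboundaries_iff f (by simp) k hjk hf i hij).2 (h f hf))
    · intro h f hf
      rw [← Cocycle.fromSingleMk_mem_coboundaries_iff f (add_zero j) k hjk hf i hij,
        ← CohomologyClass.toHom_mk_eq_zero_iff]
      exact h _
  have e : (HomotopyCategory.quotient _ (ComplexShape.up ℤ)).obj (K⟦(0 : ℤ)⟧) ≅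
      (HomotopyCategory.quotient _ _).obj K :=
    (HomotopyCategory.quotient _ _).mapIso ((shiftFunctorZero _ ℤ).app K)
  rw [← (stalks 𝒞).rightOrthogonal.prop_iff_of_iso e]
  constructor
  · rintro h Y φ ⟨P, j, hP, ⟨e'⟩⟩
    rw [← cancel_epi e'.inv, comp_zero]
    exact (key P (j - 1) j (j + 1) (by simp) rfl).1 (h P hP _ _ _ (by simp) rfl) _
  · intro h P hP i j k hij hjk
    exact (key P i j k hij hjk).2 (fun φ => h φ ⟨P, j, hP, ⟨Iso.refl _⟩⟩)

lemma finResLTSucc_self (R : Type u) [Ring R] (n : ℕ∞) :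
    finResLTSucc R n (ModuleCat.of R R) :=
  ⟨0, by simp, .zero ⟨inferInstance, inferInstance⟩⟩

lemma finPresented_self (R : Type u) [Ring R] : finPresented R (ModuleCat.of R R) :=
  inferInstanceAs (Module.FinitePresentation R R)

/-- The `n`-exact complexes, as a full subcategory of `K(R)`. -/
def nExact (R : Type u) [Ring R] (n : ℕ∞) :
    ObjectProperty (HomotopyCategory (ModuleCat.{u} R) (ComplexShape.up ℤ)) :=
  relExact (finResLTSucc R n)

/-- The pure exact complexes, as a full subcategory of `K(R)`. -/
def pureExact (R : Type u) [Ring R] :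
    ObjectProperty (HomotopyCategory (ModuleCat.{u} R) (ComplexShape.up ℤ)) :=
  relExact (finPresented R)

lemma nExact_eq (R : Type u) [Ring R] (n : ℕ∞) :
    nExact R n = (stalks (finResLTSucc R n)).rightOrthogonal :=
  relExact_eq _ (finResLTSucc_self R n)

lemma pureExact_eq (R : Type u) [Ring R] :
    pureExact R = (stalks (finPresented R)).rightOrthogonal :=
  relExact_eq _ (finPresented_self R)

instance (R : Type u) [Ring R] (n : ℕ∞) : (nExact R n).IsTriangulated := by
  rw [nExact_eq]; infer_instance

instance (R : Type u) [Ring R] (n : ℕ∞) : (nExact R n).IsClosedUnderIsomorphisms := by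
  rw [nExact_eq]; infer_instance

instance (R : Type u) [Ring R] : (pureExact R).IsTriangulated := by
  rw [pureExact_eq]; infer_instance

instance (R : Type u) [Ring R] : (pureExact R).IsClosedUnderIsomorphisms := by
  rw [pureExact_eq]; infer_instance

lemma finPresented_of_hasResolution {R : Type u} [Ring R] {k : ℕ} {M : ModuleCat.{u} R}
    (h : HasResolution (fgProjective R) k M) : finPresented R M := by
  induction h with
  | zero hM =>
    obtain ⟨h1, h2⟩ := hM
    exact Module.finitePresentation_of_projective R _
  | @succ k K P M f g w hS hP hK ih =>
    obtain ⟨h1, h2⟩ := hP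
    have h3 : Module.FinitePresentation R K := ih
    have h4 : Module.FinitePresentation R P := Module.finitePresentation_of_projective R P
    refine Module.finitePresentation_of_surjective g.hom
      ((ModuleCat.epi_iff_surjective g).1 hS.epi_g) ?_
    have := (ShortComplex.moduleCat_exact_iff_range_eq_ker _).1 hS.exact
    dsimp at this
    rw [← this]
    exact Module.Finite.fg_top.map f.hom |> fun h => by rwa [Submodule.map_top] at h

lemma pureExact_le_nExact (R : Type u) [Ring R] (n : ℕ∞) : pureExact R ≤ nExact R n := by
  intro X hX i
  obtain ⟨w, h1, h2⟩ := hX i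
  refine ⟨w, h1, fun M hM => h2 M ?_⟩
  obtain ⟨k, -, hk⟩ := hM
  exact finPresented_of_hasResolution hk

/-- The four boundedness conditions on complexes: none, bounded below, bounded above, bounded. -/
inductive Bound : Type
  | blank
  | plus
  | minus
  | b

/-- The objects of `K(R)` whose underlying complex satisfies the boundedness condition. -/
def Bound.prop (β : Bound) (R : Type u) [Ring R] :
    ObjectProperty (HomotopyCategory (ModuleCat.{u} R) (ComplexShape.up ℤ)) :=
  match β with
  | blank => fun _ => True
  | plus => fun X => ∃ a : ℤ, ∀ i < a, IsZero (X.as.X i)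
  | minus => fun X => ∃ c : ℤ, ∀ i > c, IsZero (X.as.X i)
  | b => fun X => (∃ a : ℤ, ∀ i < a, IsZero (X.as.X i)) ∧ ∃ c : ℤ, ∀ i > c, IsZero (X.as.X i)

lemma Bound.isTriangulated_aux {R : Type u} [Ring R]
    (B : ObjectProperty (HomotopyCategory (ModuleCat.{u} R) (ComplexShape.up ℤ)))
    (h₀ : ∀ X, (∀ i, IsZero (X.as.X i)) → B X)
    (h₁ : ∀ (X : CochainComplex (ModuleCat.{u} R) ℤ) (n : ℤ),
      B ((HomotopyCategory.quotient _ _).obj X) → B ((HomotopyCategory.quotient _ _).obj (X⟦n⟧)))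
    (h₂ : ∀ (X Y : CochainComplex (ModuleCat.{u} R) ℤ) (f : X ⟶ Y),
      B ((HomotopyCategory.quotient _ _).obj X) → B ((HomotopyCategory.quotient _ _).obj Y) →
      B ((HomotopyCategory.quotient _ _).obj (CochainComplex.mappingCone f))) :
    B.IsTriangulated := by
  have sh : ∀ n : ℤ, B ≤ B.shift n := by
    intro n X hX
    obtain ⟨K : CochainComplex _ _, rfl⟩ := X.quotient_obj_surjective
    rw [ObjectProperty.prop_shift_iff, HomotopyCategory.shift_quotient_obj]
    exact h₁ K n hX
  have : B.IsStableUnderShift ℤ := ⟨fun n => ⟨sh n⟩⟩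
  have : B.IsTriangulatedClosed₃ :=
    { ext₃' := fun T hT hT₁ hT₂ => by
        obtain ⟨f : T.obj₁.as ⟶ T.obj₂.as, hf⟩ :=
          (HomotopyCategory.quotient _ _).map_surjective T.mor₁
        refine ⟨_, h₂ _ _ f hT₁ hT₂, ⟨Triangle.π₃.mapIso (isoTriangleOfIso₁₂ T _ hT
          (HomotopyCategory.mappingCone_triangleh_distinguished f)
          (Iso.refl _) (Iso.refl _) ?_)⟩⟩
        exact (Category.comp_id _).trans (hf.symm.trans (Category.id_comp _).symm) }
  have : B.ContainsZero :=
    have ⟨Z, hZ⟩ := HasZeroObject.zero (C := CochainComplex (ModuleCat.{u} R) ℤ)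
    ⟨(HomotopyCategory.quotient _ _).obj Z, Functor.map_isZero _ hZ,
      h₀ _ fun i => (HomologicalComplex.eval _ _ i).map_isZero hZ⟩
  exact { toIsTriangulatedClosed₂ := .of_isTriangulatedClosed₃ }

instance (β : Bound) (R : Type u) [Ring R] : (β.prop R).IsTriangulated := by
  have sp : ∀ (X : CochainComplex (ModuleCat.{u} R) ℤ) (n : ℤ),
      (∃ a : ℤ, ∀ i < a, IsZero (X.X i)) → ∃ a : ℤ, ∀ i < a, IsZero ((X⟦n⟧).X i) :=
    fun X n ⟨a, ha⟩ => ⟨a - n, fun i hi => ha (i + n) (by lia)⟩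
  have sm : ∀ (X : CochainComplex (ModuleCat.{u} R) ℤ) (n : ℤ),
      (∃ a : ℤ, ∀ i > a, IsZero (X.X i)) → ∃ a : ℤ, ∀ i > a, IsZero ((X⟦n⟧).X i) :=
    fun X n ⟨a, ha⟩ => ⟨a - n, fun i hi => ha (i + n) (by lia)⟩
  have cp : ∀ (X Y : CochainComplex (ModuleCat.{u} R) ℤ) (f : X ⟶ Y),
      (∃ a : ℤ, ∀ i < a, IsZero (X.X i)) → (∃ a : ℤ, ∀ i < a, IsZero (Y.X i)) →
      ∃ a : ℤ, ∀ i < a, IsZero ((CochainComplex.mappingCone f).X i) :=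
    fun X Y f ⟨a, ha⟩ ⟨c, hc⟩ => ⟨min (a - 1) c, fun i hi =>
      (CochainComplex.mappingCone.isZero_X_iff f i).2 ⟨ha _ (by lia), hc _ (by lia)⟩⟩
  have cm : ∀ (X Y : CochainComplex (ModuleCat.{u} R) ℤ) (f : X ⟶ Y),
      (∃ a : ℤ, ∀ i > a, IsZero (X.X i)) → (∃ a : ℤ, ∀ i > a, IsZero (Y.X i)) →
      ∃ a : ℤ, ∀ i > a, IsZero ((CochainComplex.mappingCone f).X i) :=
    fun X Y f ⟨a, ha⟩ ⟨c, hc⟩ => ⟨max a c, fun i hi =>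
      (CochainComplex.mappingCone.isZero_X_iff f i).2 ⟨ha _ (by lia), hc _ (by lia)⟩⟩
  match β with
  | .blank =>
    exact Bound.isTriangulated_aux _ (fun _ _ => trivial) (fun _ _ _ => trivial)
      (fun _ _ _ _ _ => trivial)
  | .plus => exact Bound.isTriangulated_aux _ (fun _ h => ⟨0, fun i _ => h i⟩) sp cp
  | .minus => exact Bound.isTriangulated_aux _ (fun _ h => ⟨0, fun i _ => h i⟩) sm cm
  | .b =>
    exact Bound.isTriangulated_aux _
      (fun _ h => ⟨⟨0, fun i _ => h i⟩, ⟨0, fun i _ => h i⟩⟩)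
      (fun X n h => ⟨sp X n h.1, sm X n h.2⟩)
      (fun X Y f h h' => ⟨cp X Y f h.1 h'.1, cm X Y f h.2 h'.2⟩)

section Verdier

variable {T : Type*} [Category* T] [HasZeroObject T] [HasShift T ℤ] [Preadditive T]
  [∀ n : ℤ, (shiftFunctor T n).Additive] [Pretriangulated T] [IsTriangulated T]

/-- The Verdier quotient `T / P` of a triangulated category by a triangulated subcategory:
the localization of `T` at the morphisms whose cone belongs to `P`. For triangulated `P`, it
carries the shift and the triangulated structure for which the quotient functor is triangulated. -/
abbrev VerdierQuotient (P : ObjectProperty T) : Type _ := P.trW.Localization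

/-- The quotient functor `T ⥤ T / P`. -/
noncomputable abbrev verdierFunctor (P : ObjectProperty T) : T ⥤ VerdierQuotient P := P.trW.Q

variable (P Q : ObjectProperty T) [P.IsTriangulated] [P.IsClosedUnderIsomorphisms]
  [Q.IsTriangulated]

/-- The canonical functor `Q / (P ∩ Q) ⥤ T / P` induced by the inclusion of `Q` in `T`. -/
noncomputable def verdierSub :
    VerdierQuotient (P.inverseImage Q.ι) ⥤ VerdierQuotient P :=
  (Q.triangulatedLocalizerMorphism P).localizedFunctor
    (verdierFunctor (P.inverseImage Q.ι)) (verdierFunctor P)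

noncomputable instance : (verdierSub P Q).CommShift ℤ :=
  inferInstanceAs (((Q.triangulatedLocalizerMorphism P).localizedFunctor
    (verdierFunctor (P.inverseImage Q.ι)) (verdierFunctor P)).CommShift ℤ)

instance : (verdierSub P Q).IsTriangulated := by
  change ((Q.triangulatedLocalizerMorphism P).localizedFunctor
    (verdierFunctor (P.inverseImage Q.ι)) (verdierFunctor P)).IsTriangulated
  have : (verdierFunctor (P.inverseImage Q.ι)).mapArrow.EssSurj :=
    Localization.essSurj_mapArrow _ (P.inverseImage Q.ι).trW
  exact Functor.isTriangulated_of_precomp_iso (F := verdierFunctor (P.inverseImage Q.ι))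
    (H := (Q.triangulatedLocalizerMorphism P).functor ⋙ verdierFunctor P)
    (CatCommSq.iso (Q.triangulatedLocalizerMorphism P).functor _ _ _).symm

/-- If `P ≤ Q`, this is the identity of `T`, as a functor sending the morphisms with cone in `P`
to morphisms with cone in `Q`. -/
def verdierLocalizerMorphism {P Q : ObjectProperty T} (h : P ≤ Q) :
    LocalizerMorphism P.trW Q.trW where
  functor := 𝟭 T
  map _ _ f hf := ObjectProperty.trW_monotone h f hf

noncomputable instance {P Q : ObjectProperty T} (h : P ≤ Q) :
    (verdierLocalizerMorphism h).functor.CommShift ℤ :=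
  inferInstanceAs ((𝟭 T).CommShift ℤ)

instance {P Q : ObjectProperty T} (h : P ≤ Q) :
    (verdierLocalizerMorphism h).functor.IsTriangulated :=
  inferInstanceAs (𝟭 T).IsTriangulated

variable {P Q} in
/-- If `P ≤ Q`, this is the canonical functor `T / P ⥤ T / Q`, induced by the identity of `T`. -/
noncomputable def verdierMap (h : P ≤ Q) : VerdierQuotient P ⥤ VerdierQuotient Q :=
  (verdierLocalizerMorphism h).localizedFunctor (verdierFunctor P) (verdierFunctor Q)

variable {P Q} in
lemma verdierSub_full (h : P ≤ Q) : (verdierSub P Q).Full := by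
  have : Q.IsVerdierRightLocalizing P :=
    ⟨fun {X _} f hX _ => ⟨X, 𝟙 X, f, h X hX, hX, Category.id_comp f⟩⟩
  dsimp only [verdierSub]
  infer_instance

variable {P Q} in
lemma verdierSub_faithful (h : P ≤ Q) : (verdierSub P Q).Faithful := by
  have : Q.IsVerdierRightLocalizing P :=
    ⟨fun {X _} f hX _ => ⟨X, 𝟙 X, f, h X hX, hX, Category.id_comp f⟩⟩
  dsimp only [verdierSub]
  infer_instance

variable {P Q} in
noncomputable instance (h : P ≤ Q) : (verdierMap h).CommShift ℤ :=
  inferInstanceAs (((verdierLocalizerMorphism h).localizedFunctor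
    (verdierFunctor P) (verdierFunctor Q)).CommShift ℤ)

variable {P Q} in
instance (h : P ≤ Q) : (verdierMap h).IsTriangulated := by
  have : (verdierFunctor P).mapArrow.EssSurj := Localization.essSurj_mapArrow _ P.trW
  let e := CatCommSq.iso (verdierLocalizerMorphism h).functor (verdierFunctor P)
    (verdierFunctor Q) ((verdierLocalizerMorphism h).localizedFunctor
      (verdierFunctor P) (verdierFunctor Q))
  change ((verdierLocalizerMorphism h).localizedFunctor
    (verdierFunctor P) (verdierFunctor Q)).IsTriangulated
  exact Functor.isTriangulated_of_precomp_iso (F := verdierFunctor P)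
    (H := (verdierLocalizerMorphism h).functor ⋙ verdierFunctor Q) e.symm

/-- A functor between triangulated categories, equipped with a commutation with the shifts, is a
triangulated equivalence if it is triangulated and an equivalence of categories. -/
def IsTriangulatedEquivalence {S T : Type*} [Category* S] [Category* T]
    [HasZeroObject S] [HasZeroObject T] [HasShift S ℤ] [HasShift T ℤ]
    [Preadditive S] [Preadditive T] [∀ n : ℤ, (shiftFunctor S n).Additive]
    [∀ n : ℤ, (shiftFunctor T n).Additive] [Pretriangulated S] [Pretriangulated T]
    (F : S ⥤ T) [F.CommShift ℤ] : Prop :=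
  F.IsTriangulated ∧ F.IsEquivalence

end Verdier

lemma essImage_isTriangulated {S T : Type*} [Category* S] [Category* T]
    [HasZeroObject S] [HasZeroObject T] [HasShift S ℤ] [HasShift T ℤ]
    [Preadditive S] [Preadditive T] [∀ n : ℤ, (shiftFunctor S n).Additive]
    [∀ n : ℤ, (shiftFunctor T n).Additive] [Pretriangulated S] [Pretriangulated T]
    (F : S ⥤ T) [F.CommShift ℤ] [F.IsTriangulated] [F.Full] : F.essImage.IsTriangulated :=
  inferInstance

section DerivedCategories

variable (R : Type u) [Ring R] (n : ℕ∞) (β : Bound)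

/-- The homotopy category `K^β(R)`: the full subcategory of `K(R)` on the complexes satisfying
the boundedness condition `β`. -/
def K : Type (u + 1) := (β.prop R).FullSubcategory

instance : Category (K R β) := inferInstanceAs (Category (β.prop R).FullSubcategory)

noncomputable instance : Preadditive (K R β) :=
  inferInstanceAs (Preadditive (β.prop R).FullSubcategory)

instance : HasZeroObject (K R β) := inferInstanceAs (HasZeroObject (β.prop R).FullSubcategory)

noncomputable instance : HasShift (K R β) ℤ :=
  inferInstanceAs (HasShift (β.prop R).FullSubcategory ℤ)

instance (i : ℤ) : (shiftFunctor (K R β) i).Additive :=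
  inferInstanceAs (shiftFunctor (β.prop R).FullSubcategory i).Additive

noncomputable instance : Pretriangulated (K R β) :=
  inferInstanceAs (Pretriangulated (β.prop R).FullSubcategory)

instance : IsTriangulated (K R β) :=
  inferInstanceAs (IsTriangulated (β.prop R).FullSubcategory)

/-- The full subcategory `K^β_n(R)` of `K^β(R)` on the `n`-exact complexes. -/
def Kn : ObjectProperty (K R β) := (nExact R n).inverseImage (β.prop R).ι

instance : (Kn R n β).IsTriangulated :=
  inferInstanceAs ((nExact R n).inverseImage (β.prop R).ι).IsTriangulated

instance : (Kn R n β).IsClosedUnderIsomorphisms :=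
  inferInstanceAs ((nExact R n).inverseImage (β.prop R).ι).IsClosedUnderIsomorphisms

/-- The full subcategory `K^β_PE(R)` of `K^β(R)` on the pure exact complexes. -/
def Kpe : ObjectProperty (K R β) := (pureExact R).inverseImage (β.prop R).ι

instance : (Kpe R β).IsTriangulated :=
  inferInstanceAs ((pureExact R).inverseImage (β.prop R).ι).IsTriangulated

instance : (Kpe R β).IsClosedUnderIsomorphisms :=
  inferInstanceAs ((pureExact R).inverseImage (β.prop R).ι).IsClosedUnderIsomorphisms

lemma Kpe_le_Kn : Kpe R β ≤ Kn R n β := fun X hX => pureExact_le_nExact R n X.obj hX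

/-- The `n`-derived category `D^β_n(R) = K^β(R) / K^β_n(R)`. -/
abbrev Dn : Type (u + 1) := VerdierQuotient (Kn R n β)

/-- The pure derived category `D^β_pur(R) = K^β(R) / K^β_PE(R)`. -/
abbrev Dpur : Type (u + 1) := VerdierQuotient (Kpe R β)

/-- The Verdier quotient `K^β_{n,pur}(R) = K^β_n(R) / K^β_PE(R)`. -/
abbrev KnPur : Type (u + 1) := VerdierQuotient ((Kpe R β).inverseImage (Kn R n β).ι)

/-- The canonical functor `K^β_{n,pur}(R) ⥤ D^β_pur(R)`, induced by the inclusion of `K^β_n(R)`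
in `K^β(R)`. It is triangulated and fully faithful. -/
noncomputable abbrev knPurFunctor : KnPur R n β ⥤ Dpur R β := verdierSub (Kpe R β) (Kn R n β)

instance : (knPurFunctor R n β).Full := verdierSub_full (Kpe_le_Kn R n β)

instance : (knPurFunctor R n β).Faithful := verdierSub_faithful (Kpe_le_Kn R n β)

/-- `K^β_{n,pur}(R)` as a triangulated subcategory of `D^β_pur(R)`: the objects isomorphic to the
image of an object of `K^β_{n,pur}(R)` under the canonical fully faithful functor. -/
def knPurSub : ObjectProperty (Dpur R β) := (knPurFunctor R n β).essImage

instance : (knPurSub R n β).IsTriangulated :=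
  essImage_isTriangulated (knPurFunctor R n β)

/-- The canonical functor `D^β_pur(R) ⥤ D^β_n(R)`, induced by the identity of `K^β(R)`. -/
noncomputable abbrev purToN : Dpur R β ⥤ Dn R n β := verdierMap (Kpe_le_Kn R n β)

end DerivedCategories

section Coherence

/-- A ring is left coherent if its finitely generated left ideals are finitely presented. -/
def LeftCoherent (R : Type u) [Ring R] : Prop :=
  ∀ I : Ideal R, I.FG → Module.FinitePresentation R I

/-- The subgroup of `N ⊗[ℤ] M` generated by the elements `n r ⊗ m - n ⊗ r m`, for a right module
`N` and a left module `M` over `R`. -/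
def balancedRelations (R : Type u) [Ring R] (N : Type u) [AddCommGroup N] [Module Rᵐᵒᵖ N]
    (M : Type u) [AddCommGroup M] [Module R M] : AddSubgroup (TensorProduct ℤ N M) :=
  AddSubgroup.closure {t | ∃ (r : R) (x : N) (m : M),
    t = (MulOpposite.op r • x) ⊗ₜ[ℤ] m - x ⊗ₜ[ℤ] (r • m)}

/-- The tensor product `N ⊗_R M` of a right module `N` and a left module `M` over a (not
necessarily commutative) ring `R`. -/
abbrev BalancedTensor (R : Type u) [Ring R] (N : Type u) [AddCommGroup N] [Module Rᵐᵒᵖ N]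
    (M : Type u) [AddCommGroup M] [Module R M] : Type u :=
  TensorProduct ℤ N M ⧸ balancedRelations R N M

/-- The map `f ⊗ id : N ⊗_R M → N' ⊗_R M` induced by a map `f : N → N'` of right modules. -/
def BalancedTensor.map {R : Type u} [Ring R] {N N' : Type u} [AddCommGroup N] [Module Rᵐᵒᵖ N]
    [AddCommGroup N'] [Module Rᵐᵒᵖ N'] (f : N →ₗ[Rᵐᵒᵖ] N') (M : Type u) [AddCommGroup M]
    [Module R M] : BalancedTensor R N M →+ BalancedTensor R N' M :=
  QuotientAddGroup.map _ _ (LinearMap.rTensor M f.toAddMonoidHom.toIntLinearMap).toAddMonoidHom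
    (by
      rw [balancedRelations, AddSubgroup.closure_le]
      rintro _ ⟨r, x, m, rfl⟩
      refine AddSubgroup.subset_closure ⟨r, f x, m, ?_⟩
      simp)

/-- Flat left `R`-modules: `- ⊗_R M` preserves injectivity of maps of right modules. -/
def flat (R : Type u) [Ring R] : ObjectProperty (ModuleCat.{u} R) := fun M =>
  ∀ (N N' : Type u) [AddCommGroup N] [AddCommGroup N'] [Module Rᵐᵒᵖ N] [Module Rᵐᵒᵖ N']
    (f : N →ₗ[Rᵐᵒᵖ] N'), Function.Injective f → Function.Injective (BalancedTensor.map f M)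

/-- The flat dimension: the smallest length of a flat resolution, or `∞` if there is none. -/
noncomputable def flatDimension {R : Type u} [Ring R] (M : ModuleCat.{u} R) : ℕ∞ :=
  ⨅ (k : ℕ) (_ : HasResolution (flat R) k M), (k : ℕ∞)

/-- The weak global dimension: the supremum of the flat dimensions of all left `R`-modules. -/
noncomputable def weakGlobalDimension (R : Type u) [Ring R] : ℕ∞ :=
  ⨆ M : ModuleCat.{u} R, flatDimension M

end Coherence

end NDerived

open NDerived

/-! The first claim is the third isomorphism theorem for Verdier quotients. For triangulated `P ≤ Q`
in `T`, every morphism of `T / P` is, up to isomorphism, the image of a morphism of `T`, and its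
cone is the image of the cone. Hence inverting the morphisms of `T / P` with cone in the image of
`Q` amounts to inverting all of `Q.trW` (`exists_verdierQuotient_equivalence`). Relative exact
complexes form a right orthogonal, hence a thick subcategory, so the kernel of each quotient functor
is precisely the subcategory divided out. It follows that conditions 2 and 3 both say that every
`n`-exact complex is pure exact, that is `Kn ≤ Kpe`.

`Kn_le_Kpe_iff` compares this inclusion with condition 1. Over a coherent ring, a finitely presented
module of projective dimension `< n+1` is resolved by its finitely generated syzygies, so it lies in
`𝒫^{<n+1}`, and `n`-exactness tests against all finitely presented modules. Conversely, cover a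
finitely presented `M` by a direct sum `E` of modules of `𝒫^{<n+1}` through which every map from
such a module lifts. The kernel sequence is `n`-exact. Read as a three-term complex it satisfies
every boundedness condition, so by assumption it is pure exact and `E → M` splits. The section lands
in a finite subsum, so `M` is a retract of some `C` in `𝒫^{<n+1}` and its projective dimension is
bounded. Coherence follows by taking `M = R/I`: Schanuel's argument turns a resolution of `C` into
finite presentation of `I`.

For finite `n` the weak dimension enters through `LeftCoherent.weakGlobalDimension_lt_iff`.
Character modules turn flat resolutions into injective coresolutions, and over a coherent ring a
finitely presented module with character module of injective dimension at most `k` has projective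
dimension at most `k`, since finitely presented flat modules are projective. In the other direction,
the property that all maps from finitely presented modules factor through finitely presented modules
of projective dimension at most `k` passes to free syzygies with `k` lowered by one, and for `k = 0`
it forces flatness. -/

namespace NDerived

/-! ### Kernels of Verdier quotients and iterated quotients. -/

section VerdierKernel

open scoped ZeroObject

variable {T : Type*} [Category* T] [HasZeroObject T] [HasShift T ℤ] [Preadditive T]
  [∀ n : ℤ, (shiftFunctor T n).Additive] [Pretriangulated T] [IsTriangulated T]

lemma isStableUnderRetracts_rightOrthogonal {C : Type*} [Category* C] [HasZeroMorphisms C]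
    (P : ObjectProperty C) : P.rightOrthogonal.IsStableUnderRetracts where
  of_retract {X Y} r hY := fun Z f hZ => by
    rw [← Category.comp_id f, ← r.retract, ← Category.assoc, hY (f ≫ r.i) hZ, zero_comp]

/-- The kernel of the Verdier quotient functor of a thick subcategory is this subcategory. -/
lemma isZero_verdierFunctor_obj_iff (P : ObjectProperty T) [P.IsTriangulated]
    [P.IsStableUnderRetracts] (X : T) : IsZero ((verdierFunctor P).obj X) ↔ P X := by
  constructor
  · intro hX
    have h0 : (verdierFunctor P).map (𝟙 X) = (verdierFunctor P).map 0 := hX.eq_of_src _ _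
    obtain ⟨Z, s, hs, h⟩ :=
      (MorphismProperty.map_eq_iff_postcomp (verdierFunctor P) P.trW _ _).1 h0
    obtain rfl : s = 0 := by simpa using h
    obtain ⟨C, g, k, hT, hC⟩ := (P.trW_iff _).1 hs
    -- The zero map `X ⟶ Z` has cone `C` in `P`. Since the shifted map is zero too, the identity of
    -- `X⟦1⟧` factors through `C`, so `X⟦1⟧` is a retract of `C`.
    obtain ⟨t, ht⟩ := Triangle.coyoneda_exact₁ _ hT (𝟙 (X⟦(1 : ℤ)⟧)) (by
      change 𝟙 _ ≫ (0 : X ⟶ Z)⟦(1 : ℤ)⟧' = 0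
      rw [Functor.map_zero, comp_zero])
    have : P (X⟦(1 : ℤ)⟧) := P.prop_of_retract ⟨t, k, ht.symm⟩ hC
    have h' := P.le_shift (-1 : ℤ) _ this
    let e := shiftShiftNeg X (1 : ℤ)
    exact P.prop_of_retract (Y := (X⟦(1 : ℤ)⟧)⟦(-1 : ℤ)⟧) ⟨e.inv, e.hom, e.inv_hom_id⟩ h'
  · intro hX
    -- The cone of `0 ⟶ X` is `X` itself, so this map becomes invertible.
    have : P.trW (0 : (0 : T) ⟶ X) := ⟨_, _, _, contractible_distinguished₁ X, hX⟩
    have := Localization.inverts (verdierFunctor P) P.trW _ this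
    exact ((verdierFunctor P).map_isZero (isZero_zero T)).of_iso
      (asIso ((verdierFunctor P).map (0 : (0 : T) ⟶ X))).symm

variable {P Q : ObjectProperty T} [P.IsTriangulated] [P.IsClosedUnderIsomorphisms]
  [Q.IsTriangulated]

/-- The canonical functor `T / P ⥤ T / Q` extends the projection of `T`. -/
noncomputable def verdierMapIso (h : P ≤ Q) :
    verdierFunctor P ⋙ verdierMap h ≅ verdierFunctor Q :=
  (CatCommSq.iso (verdierLocalizerMorphism h).functor (verdierFunctor P)
    (verdierFunctor Q) ((verdierLocalizerMorphism h).localizedFunctor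
      (verdierFunctor P) (verdierFunctor Q))).symm ≪≫ Functor.leftUnitor _

omit [P.IsTriangulated] [P.IsClosedUnderIsomorphisms] in
lemma isZero_verdierMap_obj_iff [Q.IsStableUnderRetracts] (h : P ≤ Q) (X : T) :
    IsZero ((verdierMap h).obj ((verdierFunctor P).obj X)) ↔ Q X := by
  rw [← isZero_verdierFunctor_obj_iff Q]
  exact ((verdierMapIso h).app X).isZero_iff

omit [P.IsTriangulated] [P.IsClosedUnderIsomorphisms] in
/-- The image of `Q / P` in `T / P` consists of the images of the objects of `Q`. -/
lemma essImage_verdierSub_iff [Q.IsStableUnderRetracts] (h : P ≤ Q) (X : T) :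
    (verdierSub P Q).essImage ((verdierFunctor P).obj X) ↔ Q X := by
  let e := CatCommSq.iso (Q.triangulatedLocalizerMorphism P).functor
    (verdierFunctor (P.inverseImage Q.ι)) (verdierFunctor P)
    ((Q.triangulatedLocalizerMorphism P).localizedFunctor
      (verdierFunctor (P.inverseImage Q.ι)) (verdierFunctor P))
  constructor
  · rintro ⟨Y, ⟨i⟩⟩
    have := Localization.essSurj (verdierFunctor (P.inverseImage Q.ι)) (P.inverseImage Q.ι).trW
    let j := (verdierFunctor (P.inverseImage Q.ι)).objObjPreimageIso Y
    let Z := (verdierFunctor (P.inverseImage Q.ι)).objPreimage Y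
    let k : (verdierFunctor P).obj Z.obj ≅ (verdierFunctor P).obj X :=
      e.app Z ≪≫ (verdierSub P Q).mapIso j ≪≫ i
    -- Membership in `Q` is detected by vanishing in `T / Q`, which is invariant under isomorphisms
    -- of `T / P`.
    rw [← isZero_verdierMap_obj_iff h, ← ((verdierMap h).mapIso k).isZero_iff,
      isZero_verdierMap_obj_iff]
    exact Z.property
  · intro hX
    exact ⟨_, ⟨(e.app ⟨X, hX⟩).symm⟩⟩

-- Arrows of `T / P` lift to `T` up to isomorphism. The quotient functor is triangulated, so the
-- cone of the lift maps to the cone of the given arrow, and `hA` translates membership in `A` into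
-- membership in `Q`.
omit [P.IsClosedUnderIsomorphisms] [Q.IsTriangulated] in
lemma trW_le_map_verdierFunctor (A : ObjectProperty (VerdierQuotient P)) [A.IsTriangulated]
    [A.IsClosedUnderIsomorphisms] (hA : ∀ X, A ((verdierFunctor P).obj X) ↔ Q X) :
    A.trW ≤ Q.trW.map (verdierFunctor P) := by
  intro X Y f hf
  have : (verdierFunctor P).mapArrow.EssSurj := Localization.essSurj_mapArrow _ P.trW
  let e := (verdierFunctor P).mapArrow.objObjPreimageIso (Arrow.mk f)
  let g := (verdierFunctor P).mapArrow.objPreimage (Arrow.mk f)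
  refine ⟨_, _, g.hom, ?_, ⟨e⟩⟩
  obtain ⟨Z, a, b, hT⟩ := distinguished_cocone_triangle g.hom
  exact ⟨Z, a, b, hT, (hA Z).1 ((A.trW_iff_of_distinguished _
    ((verdierFunctor P).map_distinguished _ hT)).1 ((A.trW.arrow_mk_iso_iff e).2 hf))⟩

-- Two successive localizations compose: the second inverts only images of `Q.trW`, and all of those
-- are inverted.
omit [P.IsClosedUnderIsomorphisms] [Q.IsTriangulated] in
lemma isLocalization_verdierFunctor_comp (h : P ≤ Q)
    (A : ObjectProperty (VerdierQuotient P)) [A.IsTriangulated] [A.IsClosedUnderIsomorphisms]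
    (hA : ∀ X, A ((verdierFunctor P).obj X) ↔ Q X) :
    (verdierFunctor P ⋙ verdierFunctor A).IsLocalization Q.trW := by
  refine Functor.IsLocalization.comp (verdierFunctor P) (verdierFunctor A) P.trW A.trW Q.trW
    ?_ (ObjectProperty.trW_monotone h) (trW_le_map_verdierFunctor A hA)
  rintro X Y f ⟨Z, g, k, hT, hZ⟩
  exact Localization.inverts (verdierFunctor A) A.trW _
    ⟨_, _, _, (verdierFunctor P).map_distinguished _ hT, (hA Z).2 hZ⟩

omit [P.IsClosedUnderIsomorphisms] in
/-- For triangulated subcategories `P ≤ Q` of `T`, the category `T / Q` is the Verdier quotient of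
`T / P` by the image of `Q`. -/
lemma exists_verdierQuotient_equivalence (h : P ≤ Q)
    (A : ObjectProperty (VerdierQuotient P)) [A.IsTriangulated]
    [A.IsClosedUnderIsomorphisms]
    (hA : ∀ X, A ((verdierFunctor P).obj X) ↔ Q X) :
    ∃ (F : VerdierQuotient A ⥤ VerdierQuotient Q) (_ : F.CommShift ℤ),
      IsTriangulatedEquivalence F ∧ Nonempty (verdierFunctor A ⋙ F ≅ verdierMap h) := by
  have hloc := isLocalization_verdierFunctor_comp h A hA
  have hinv : A.trW.IsInvertedBy (verdierMap h) := by
    refine MorphismProperty.IsInvertedBy.of_le _ _ _ ?_ (trW_le_map_verdierFunctor A hA)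
    rw [MorphismProperty.IsInvertedBy.map_iff,
      MorphismProperty.IsInvertedBy.iff_of_iso _ (verdierMapIso h)]
    exact Localization.inverts _ _
  let F := Localization.lift (verdierMap h) hinv (verdierFunctor A)
  let : F.CommShift ℤ :=
    Functor.commShiftOfLocalization (verdierFunctor A) A.trW ℤ (verdierMap h) F
  let e : verdierFunctor A ⋙ F ≅ verdierMap h :=
    Localization.Lifting.iso (verdierFunctor A) A.trW (verdierMap h) F
  have : NatTrans.CommShift e.hom ℤ :=
    NatTrans.commShift_iso_hom_of_localization (verdierFunctor A) A.trW ℤ (verdierMap h) F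
  refine ⟨F, inferInstance, ⟨?_, ?_⟩, ⟨e⟩⟩
  · have : (verdierFunctor A).mapArrow.EssSurj := Localization.essSurj_mapArrow _ A.trW
    exact Functor.isTriangulated_of_precomp_iso e
  -- Source and target of `F` are both localizations of `T` at `Q.trW`, and `F` is compatible with
  -- the functors from `T`.
  · let : CatCommSq (LocalizerMorphism.id Q.trW).functor (verdierFunctor P ⋙ verdierFunctor A)
        (verdierFunctor Q) F :=
      ⟨Functor.leftUnitor _ ≪≫ (verdierMapIso h).symm ≪≫ Functor.isoWhiskerLeft _ e.symm ≪≫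
        (Functor.associator _ _ _).symm⟩
    exact LocalizerMorphism.isEquivalence (LocalizerMorphism.id Q.trW)
      (verdierFunctor P ⋙ verdierFunctor A) (verdierFunctor Q) F

-- A faithful functor reflects zero objects, so an equivalence forces the kernels `P` and `Q` of the
-- two projections from `T` to coincide.
omit [P.IsClosedUnderIsomorphisms] in
lemma isEquivalence_verdierMap_iff [Q.IsStableUnderRetracts] [P.IsStableUnderRetracts]
    (h : P ≤ Q) : (verdierMap h).IsEquivalence ↔ Q ≤ P := by
  constructor
  · intro _ X hX
    rw [← isZero_verdierFunctor_obj_iff P, IsZero.iff_id_eq_zero]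
    exact (verdierMap h).map_injective (((isZero_verdierMap_obj_iff h X).2 hX).eq_of_src _ _)
  · intro h'
    obtain rfl := le_antisymm h h'
    let : CatCommSq (LocalizerMorphism.id P.trW).functor (verdierFunctor P)
        (verdierFunctor P) (verdierMap h) :=
      ⟨Functor.leftUnitor _ ≪≫ (verdierMapIso h).symm⟩
    exact LocalizerMorphism.isEquivalence (LocalizerMorphism.id P.trW)
      (verdierFunctor P) (verdierFunctor P) (verdierMap h)

lemma forall_isZero_verdierQuotient_iff [P.IsStableUnderRetracts] :
    (∀ X : VerdierQuotient (P.inverseImage Q.ι), IsZero X) ↔ Q ≤ P := by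
  have : (P.inverseImage Q.ι).IsStableUnderRetracts :=
    ⟨fun r hY => P.prop_of_retract (r.map Q.ι) hY⟩
  have := Localization.essSurj (verdierFunctor (P.inverseImage Q.ι)) (P.inverseImage Q.ι).trW
  constructor
  · intro H X hX
    exact (isZero_verdierFunctor_obj_iff (P.inverseImage Q.ι) ⟨X, hX⟩).1 (H _)
  · intro H X
    refine IsZero.of_iso ?_ ((verdierFunctor (P.inverseImage Q.ι)).objObjPreimageIso X).symm
    exact (isZero_verdierFunctor_obj_iff (P.inverseImage Q.ι) _).2
      (H _ (ObjectProperty.FullSubcategory.property _))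

end VerdierKernel

/-- Thickness, through the description as a right orthogonal, is what identifies the kernels of the
quotient functors. -/
instance (R : Type u) [Ring R] (n : ℕ∞) : (nExact R n).IsStableUnderRetracts := by
  rw [nExact_eq]; exact isStableUnderRetracts_rightOrthogonal _

instance (R : Type u) [Ring R] : (pureExact R).IsStableUnderRetracts := by
  rw [pureExact_eq]; exact isStableUnderRetracts_rightOrthogonal _

instance (R : Type u) [Ring R] (n : ℕ∞) (β : Bound) : (Kn R n β).IsStableUnderRetracts where
  of_retract r hY := (nExact R n).prop_of_retract (r.map (β.prop R).ι) hY

instance (R : Type u) [Ring R] (β : Bound) : (Kpe R β).IsStableUnderRetracts where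
  of_retract r hY := (pureExact R).prop_of_retract (r.map (β.prop R).ι) hY

/-! ### Finite projective resolutions, coherence and projective dimension. -/

section Resolutions

variable {R : Type u} [Ring R]

lemma HasResolution.of_exact {𝒞 : ObjectProperty (ModuleCat.{u} R)} {k : ℕ} {K P M : Type u}
    [AddCommGroup K] [AddCommGroup P] [AddCommGroup M] [Module R K] [Module R P] [Module R M]
    (f : K →ₗ[R] P) (g : P →ₗ[R] M) (hf : Function.Injective f) (hfg : Function.Exact f g)
    (hg : Function.Surjective g) (hP : 𝒞 (ModuleCat.of R P))
    (hK : HasResolution 𝒞 k (ModuleCat.of R K)) : HasResolution 𝒞 (k + 1) (ModuleCat.of R M) :=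
  .succ (ModuleCat.ofHom f) (ModuleCat.ofHom g) (by ext x; exact hfg.apply_apply_eq_zero x)
    (ModuleCat.shortComplex_shortExact _ hfg hf hg) hP hK

lemma HasResolution.of_linearEquiv {𝒞 : ObjectProperty (ModuleCat.{u} R)}
    [𝒞.IsClosedUnderIsomorphisms] {k : ℕ} {M : ModuleCat.{u} R} {N : Type u}
    [AddCommGroup N] [Module R N] (h : HasResolution 𝒞 k M) (e : M ≃ₗ[R] N) :
    HasResolution 𝒞 k (ModuleCat.of R N) := by
  cases h with
  | zero hM => exact .zero (𝒞.prop_of_iso e.toModuleIso hM)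
  | @succ k K P M f g w hS hP hK =>
    have h1 := (ShortComplex.ShortExact.moduleCat_exact_iff_function_exact _).1 hS.exact
    exact .of_exact f.hom (e.toLinearMap ∘ₗ g.hom) ((ModuleCat.mono_iff_injective f).1 hS.mono_f)
      (e.injective.comp_exact_iff_exact.2 h1)
      (e.surjective.comp ((ModuleCat.epi_iff_surjective g).1 hS.epi_g)) hP hK

instance : (fgProjective R).IsClosedUnderIsomorphisms where
  of_iso e := fun ⟨_, _⟩ =>
    ⟨Module.Finite.equiv e.toLinearEquiv, Module.Projective.of_equiv e.toLinearEquiv⟩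

lemma HasResolution.succ_of_fgProjective {k : ℕ} {M : ModuleCat.{u} R}
    (h : HasResolution (fgProjective R) k M) : HasResolution (fgProjective R) (k + 1) M := by
  induction h with
  | @zero M hM =>
    -- The resolution is lengthened by a zero term: `0 → 0 → M → M → 0`.
    exact .of_exact (K := PUnit) (0 : PUnit.{u + 1} →ₗ[R] M) (LinearMap.id)
      (Function.injective_of_subsingleton _) (by intro x; simp [eq_comm]) Function.surjective_id hM
      (.zero ⟨inferInstance, inferInstance⟩)
  | succ f g w hS hP hK ih => exact .succ f g w hS hP ih

lemma HasResolution.mono_of_fgProjective {k l : ℕ} {M : ModuleCat.{u} R}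
    (h : HasResolution (fgProjective R) k M) (hkl : k ≤ l) :
    HasResolution (fgProjective R) l M := by
  induction hkl with
  | refl => exact h
  | step _ ih => exact ih.succ_of_fgProjective

lemma HasResolution.prod_of_fgProjective {k : ℕ} {M N : ModuleCat.{u} R}
    (hM : HasResolution (fgProjective R) k M) (hN : HasResolution (fgProjective R) k N) :
    HasResolution (fgProjective R) k (ModuleCat.of R (M × N)) := by
  induction k generalizing M N with
  | zero =>
    obtain ⟨⟨_, _⟩⟩ := hM
    obtain ⟨⟨_, _⟩⟩ := hN
    exact .zero ⟨inferInstanceAs (Module.Finite R (M × N)),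
      inferInstanceAs (Module.Projective R (M × N))⟩
  | succ k ih =>
    obtain _ | @⟨_, K, P, _, f, g, w, hS, hP, hK⟩ := hM
    obtain _ | @⟨_, K', P', _, f', g', w', hS', hP', hK'⟩ := hN
    have h1 := (ShortComplex.ShortExact.moduleCat_exact_iff_function_exact _).1 hS.exact
    have h1' := (ShortComplex.ShortExact.moduleCat_exact_iff_function_exact _).1 hS'.exact
    obtain ⟨_, _⟩ := hP
    obtain ⟨_, _⟩ := hP'
    refine .of_exact (K := K × K') (P := P × P') (f.hom.prodMap f'.hom) (g.hom.prodMap g'.hom)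
      ?_ ?_ ?_ ⟨inferInstanceAs (Module.Finite R (P × P')),
        inferInstanceAs (Module.Projective R (P × P'))⟩ (ih hK hK')
    · exact ((ModuleCat.mono_iff_injective f).1 hS.mono_f).prodMap
        ((ModuleCat.mono_iff_injective f').1 hS'.mono_f)
    · rintro ⟨x, y⟩
      have h2 := h1 x
      have h2' := h1' y
      dsimp at h2 h2'
      simp [Prod.ext_iff, h2, h2']
    · exact ((ModuleCat.epi_iff_surjective g).1 hS.epi_g).prodMap
        ((ModuleCat.epi_iff_surjective g').1 hS'.epi_g)

lemma HasResolution.hasProjectiveDimensionLT {k : ℕ} {M : ModuleCat.{u} R}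
    (h : HasResolution (fgProjective R) k M) : HasProjectiveDimensionLT M (k + 1) := by
  induction h with
  | @zero M hM =>
    have := (IsProjective.iff_projective M).1 hM.2
    infer_instance
  | @succ k K P M f g w hS hP hK ih =>
    have := (IsProjective.iff_projective P).1 hP.2
    exact hS.hasProjectiveDimensionLT_X₃ (k + 1) ih inferInstance

lemma finResLTSucc_prod {n : ℕ∞} {M N : ModuleCat.{u} R} (hM : finResLTSucc R n M)
    (hN : finResLTSucc R n N) : finResLTSucc R n (ModuleCat.of R (M × N)) := by
  obtain ⟨k, hk, hM⟩ := hM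
  obtain ⟨l, hl, hN⟩ := hN
  refine ⟨max k l, ?_, (hM.mono_of_fgProjective (le_max_left k l)).prod_of_fgProjective
    (hN.mono_of_fgProjective (le_max_right k l))⟩
  rcases max_choice k l with h | h <;> rw [h] <;> assumption

/-- The pullback of two surjections with the same target. -/
lemma exists_pullback_of_surjective {M F P : Type u} [AddCommGroup M]
    [AddCommGroup F] [AddCommGroup P] [Module R M] [Module R F] [Module R P]
    (p : F →ₗ[R] M) (q : P →ₗ[R] M) (hp : Function.Surjective p) (hq : Function.Surjective q) :
    ∃ (Z : Type u) (_ : AddCommGroup Z) (_ : Module R Z) (a : Z →ₗ[R] F) (b : Z →ₗ[R] P),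
      Function.Surjective a ∧ Function.Surjective b ∧
        Nonempty (LinearMap.ker p ≃ₗ[R] LinearMap.ker b) ∧
        Nonempty (LinearMap.ker q ≃ₗ[R] LinearMap.ker a) := by
  let Z := LinearMap.eqLocus (p ∘ₗ LinearMap.fst R F P) (q ∘ₗ LinearMap.snd R F P)
  have hZ : ∀ z : F × P, z ∈ Z ↔ p z.1 = q z.2 := fun z => Iff.rfl
  let a : Z →ₗ[R] F := LinearMap.fst R F P ∘ₗ Z.subtype
  let b : Z →ₗ[R] P := LinearMap.snd R F P ∘ₗ Z.subtype
  refine ⟨Z, inferInstance, inferInstance, a, b, fun x => ?_, fun y => ?_, ⟨?_⟩, ⟨?_⟩⟩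
  · obtain ⟨y, hy⟩ := hq (p x)
    exact ⟨⟨(x, y), hy.symm⟩, rfl⟩
  · obtain ⟨x, hx⟩ := hp (q y)
    exact ⟨⟨(x, y), hx⟩, rfl⟩
  · exact
    { toFun x := ⟨⟨(x.1, 0), by simp [hZ]⟩, rfl⟩
      map_add' x y := by ext <;> simp
      map_smul' r x := by ext <;> simp
      invFun z := ⟨z.1.1.1, by
        have h1 : p z.1.1.1 = q z.1.1.2 := z.1.2
        have h2 : z.1.1.2 = 0 := z.2
        rw [LinearMap.mem_ker, h1, h2, map_zero]⟩
      left_inv x := rfl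
      right_inv z := by
        have h2 : z.1.1.2 = 0 := z.2
        ext <;> simp [h2] }
  · exact
    { toFun y := ⟨⟨(0, y.1), by simp [hZ]⟩, rfl⟩
      map_add' x y := by ext <;> simp
      map_smul' r x := by ext <;> simp
      invFun z := ⟨z.1.1.2, by
        have h1 : p z.1.1.1 = q z.1.1.2 := z.1.2
        have h2 : z.1.1.1 = 0 := z.2
        rw [LinearMap.mem_ker, ← h1, h2, map_zero]⟩
      left_inv x := rfl
      right_inv z := by
        have h2 : z.1.1.1 = 0 := z.2
        ext <;> simp [h2] }

/-- If a cover of a module by a projective module has a finitely presented kernel, then so does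
every cover by a finitely presented module. -/
lemma finitePresentation_ker_of_finitePresentation_ker {M F P : Type u} [AddCommGroup M]
    [AddCommGroup F] [AddCommGroup P] [Module R M] [Module R F] [Module R P]
    [Module.Projective R F] [Module.FinitePresentation R P] (p : F →ₗ[R] M) (q : P →ₗ[R] M)
    (hp : Function.Surjective p) (hq : Function.Surjective q)
    [Module.FinitePresentation R (LinearMap.ker p)] :
    Module.FinitePresentation R (LinearMap.ker q) := by
  -- Schanuel's argument: the pullback `Z` is an extension of `P` by `ker p`, hence finitely
  -- presented, and `ker q` splits off from it because `F` is projective.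
  obtain ⟨Z, _, _, a, b, ha, hb, ⟨e⟩, ⟨e'⟩⟩ := exists_pullback_of_surjective p q hp hq
  have : Module.FinitePresentation R (LinearMap.ker b) := .of_equiv e
  have : Module.FinitePresentation R Z := Module.finitePresentation_of_ker b hb
  have : Module.FinitePresentation R (LinearMap.ker a) :=
    Module.finitePresentation_of_projective_of_exact (LinearMap.ker a).subtype a
      (Submodule.injective_subtype _) ha (LinearMap.exact_subtype_ker_map a)
  exact .of_equiv e'.symm

/-- Induction on the rank: the first coordinate exhibits `U` as an extension of a finitely generated
left ideal by a submodule of a free module of smaller rank. That submodule is again finitely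
generated because the ideal is finitely presented. -/
lemma LeftCoherent.finitePresentation_of_injective (hR : LeftCoherent R) (m : ℕ) {U : Type u}
    [AddCommGroup U] [Module R U] [Module.Finite R U] (f : U →ₗ[R] (Fin m → R))
    (hf : Function.Injective f) : Module.FinitePresentation R U := by
  induction m generalizing U with
  | zero =>
    have := hf.subsingleton
    infer_instance
  | succ m ih =>
    let p : U →ₗ[R] R := LinearMap.proj 0 ∘ₗ f
    have : Module.FinitePresentation R (LinearMap.range p) := hR _ (Submodule.fg_range p)
    have hs := LinearMap.surjective_rangeRestrict p
    have h1 := Module.FinitePresentation.fg_ker p.rangeRestrict hs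
    have : Module.Finite R (LinearMap.ker p.rangeRestrict) := .of_fg h1
    have : Module.FinitePresentation R (LinearMap.ker p.rangeRestrict) :=
      -- The first coordinate vanishes on the kernel, so forgetting it stays injective.
      ih (LinearMap.funLeft R R Fin.succ ∘ₗ f ∘ₗ Submodule.subtype _) (by
        intro x y hxy
        refine Subtype.ext (hf (funext fun i => ?_))
        have hx : ∀ z : LinearMap.ker p.rangeRestrict, f z 0 = 0 := fun z =>
          congr_arg Subtype.val z.2
        refine Fin.cases ?_ (fun j => ?_) i
        · rw [hx, hx]
        · exact congr_fun hxy j)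
    exact Module.finitePresentation_of_ker p.rangeRestrict hs

lemma LeftCoherent.finitePresentation_ker (hR : LeftCoherent R) {m : ℕ} {M : Type u}
    [AddCommGroup M] [Module R M] [Module.FinitePresentation R M] (f : (Fin m → R) →ₗ[R] M)
    (hf : Function.Surjective f) : Module.FinitePresentation R (LinearMap.ker f) := by
  have : Module.Finite R (LinearMap.ker f) := .of_fg (Module.FinitePresentation.fg_ker f hf)
  exact hR.finitePresentation_of_injective m (LinearMap.ker f).subtype
    (Submodule.injective_subtype _)

/-- Coherence keeps the syzygies finitely presented, and each one lowers the projective dimension by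
one, until a projective module remains. -/
lemma LeftCoherent.hasResolution (hR : LeftCoherent R) (k : ℕ) (M : Type u)
    [AddCommGroup M] [Module R M] [Module.FinitePresentation R M]
    (h : HasProjectiveDimensionLT (ModuleCat.of R M) (k + 1)) :
    HasResolution (fgProjective R) k (ModuleCat.of R M) := by
  induction k generalizing M with
  | zero =>
    exact .zero ⟨inferInstanceAs (Module.Finite R M),
      (IsProjective.iff_projective M).2 (projective_iff_hasProjectiveDimensionLT_one.2 h)⟩
  | succ k ih =>
    obtain ⟨m, f, hf⟩ := Module.Finite.exists_fin' R M
    have := hR.finitePresentation_ker f hf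
    exact .of_exact (LinearMap.ker f).subtype f (Submodule.injective_subtype _)
      (LinearMap.exact_subtype_ker_map f) hf
      ⟨inferInstanceAs (Module.Finite R (Fin m → R)),
        inferInstanceAs (Module.Projective R (Fin m → R))⟩
      (ih _ ((LinearMap.shortExact_shortComplexKer hf).hasProjectiveDimensionLT_X₁ (k + 1)
        inferInstance h))

lemma projectiveDimension_lt_coe_succ_iff (M : ModuleCat.{u} R) (n : ℕ∞) :
    projectiveDimension M < ((n + 1 : ℕ∞) : WithBot ℕ∞) ↔
      ∃ k : ℕ, (k : ℕ∞) < n + 1 ∧ HasProjectiveDimensionLT M (k + 1) := by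
  induction n with
  | top =>
    rw [top_add, WithBot.coe_top, lt_top_iff_ne_top, projectiveDimension_ne_top_iff]
    simp
  | coe m =>
    have h : (((m : ℕ∞) + 1 : ℕ∞) : WithBot ℕ∞) = ((m + 1 : ℕ) : WithBot ℕ∞) := rfl
    rw [h, projectiveDimension_lt_iff]
    constructor
    · exact fun h => ⟨m, by exact_mod_cast Nat.lt_succ_self m, h⟩
    · rintro ⟨k, hk, hM⟩
      have hk : k < m + 1 := by exact_mod_cast hk
      exact hasProjectiveDimensionLT_of_ge _ (k + 1) _ (by lia)

end Resolutions

/-! ### From `Kn ≤ Kpe` to coherence and bounded projective dimension. -/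

section ThreeTermComplexes

variable {R : Type u} [Ring R]

/-- The terms of the complex `⋯ ⟶ 0 ⟶ X₁ ⟶ X₂ ⟶ X₃ ⟶ 0 ⟶ ⋯`, with `X₁` in degree `0`. -/
def threeTermX (S : ShortComplex (ModuleCat.{u} R)) : ℤ → ModuleCat.{u} R
  | 0 => S.X₁
  | 1 => S.X₂
  | 2 => S.X₃
  | _ => ModuleCat.of R PUnit

/-- The differentials of the complex `⋯ ⟶ 0 ⟶ X₁ ⟶ X₂ ⟶ X₃ ⟶ 0 ⟶ ⋯`. -/
def threeTermD (S : ShortComplex (ModuleCat.{u} R)) :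
    ∀ i j : ℤ, threeTermX S i ⟶ threeTermX S j := fun i j =>
  if h : i = 0 ∧ j = 1 then eqToHom (by rw [h.1]; rfl) ≫ S.f ≫ eqToHom (by rw [h.2]; rfl)
  else if h : i = 1 ∧ j = 2 then eqToHom (by rw [h.1]; rfl) ≫ S.g ≫ eqToHom (by rw [h.2]; rfl)
  else 0

lemma threeTermD_zero_one (S : ShortComplex (ModuleCat.{u} R)) : threeTermD S 0 1 = S.f :=
  (Category.id_comp _).trans (Category.comp_id _)

lemma threeTermD_one_two (S : ShortComplex (ModuleCat.{u} R)) : threeTermD S 1 2 = S.g :=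
  (Category.id_comp _).trans (Category.comp_id _)

lemma isZero_threeTermX (S : ShortComplex (ModuleCat.{u} R)) (i : ℤ) (h0 : i ≠ 0) (h1 : i ≠ 1)
    (h2 : i ≠ 2) : IsZero (threeTermX S i) := by
  rw [threeTermX.eq_4 S i h0 h1 h2]
  exact ModuleCat.isZero_of_subsingleton _

lemma threeTermD_eq_zero (S : ShortComplex (ModuleCat.{u} R)) (i j : ℤ)
    (h0 : i = 0 → j ≠ 1) (h1 : i = 1 → j ≠ 2) : threeTermD S i j = 0 :=
  (dif_neg fun h => h0 h.1 h.2).trans (dif_neg fun h => h1 h.1 h.2)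

/-- The complex `⋯ ⟶ 0 ⟶ X₁ ⟶ X₂ ⟶ X₃ ⟶ 0 ⟶ ⋯`, with `X₁` in degree `0`. -/
def threeTermComplex (S : ShortComplex (ModuleCat.{u} R)) :
    CochainComplex (ModuleCat.{u} R) ℤ where
  X := threeTermX S
  d := threeTermD S
  shape i j hij := threeTermD_eq_zero S i j (by rintro rfl rfl; simp at hij)
    (by rintro rfl rfl; simp at hij)
  d_comp_d' i j k hij hjk := by
    by_cases h0 : i = 0
    · obtain rfl : i = 0 := h0
      obtain rfl : j = 1 := by simpa using hij.symm
      obtain rfl : k = 2 := by simpa using hjk.symm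
      rw [threeTermD_zero_one, threeTermD_one_two]
      exact S.zero
    · by_cases h1 : i = 1
      · rw [threeTermD_eq_zero S j k (by simp at hij; lia) (by simp at hij; lia), comp_zero]
      · rw [threeTermD_eq_zero S i j (by lia) (by lia), zero_comp]

/-- Lifting of cocycles in degrees `0` and `1` is automatic from short exactness; only degree `2`,
where every map is a cocycle, depends on the class. -/
lemma relExactAt_threeTermComplex_iff {𝒞 : ObjectProperty (ModuleCat.{u} R)}
    (h𝒞 : 𝒞 (ModuleCat.of R R)) {S : ShortComplex (ModuleCat.{u} R)} (hS : S.ShortExact) :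
    (∀ i, RelExactAt 𝒞 (threeTermComplex S) i) ↔
      ∀ M, 𝒞 M → ∀ f : M ⟶ S.X₃, ∃ g : M ⟶ S.X₂, g ≫ S.g = f := by
  rw [relExactAt_iff 𝒞 h𝒞]
  constructor
  · intro h M hM f
    rw [← threeTermD_one_two]
    exact h M hM 1 2 3 rfl rfl f
      ((isZero_threeTermX S 3 (by simp) (by simp) (by simp)).eq_of_tgt _ _)
  · intro h M hM i j k hij hjk f hf
    by_cases h0 : j = 0
    · obtain rfl := h0
      obtain rfl : k = 1 := by lia
      refine ⟨0, ?_⟩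
      rw [zero_comp]
      have := hS.mono_f
      have hf' : (f : M ⟶ S.X₁) ≫ S.f = 0 := by
        rw [← threeTermD_zero_one]; exact hf
      exact ((cancel_mono S.f).1 (hf'.trans zero_comp.symm)).symm
    by_cases h1 : j = 1
    · obtain rfl := h1
      obtain rfl : k = 2 := by lia
      obtain rfl : i = 0 := by lia
      have := hS.mono_f
      have hf' : (f : M ⟶ S.X₂) ≫ S.g = 0 := by rw [← threeTermD_one_two]; exact hf
      exact ⟨hS.exact.lift f hf', (congr_arg _ (threeTermD_zero_one S)).trans
        (hS.exact.lift_f f hf')⟩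
    by_cases h2 : j = 2
    · obtain rfl := h2
      obtain rfl : i = 1 := by lia
      obtain ⟨g, hg⟩ := h M hM f
      exact ⟨g, (congr_arg _ (threeTermD_one_two S)).trans hg⟩
    · exact ⟨0, (isZero_threeTermX S j h0 h1 h2).eq_of_tgt _ _⟩

lemma prop_threeTermComplex (β : Bound) (S : ShortComplex (ModuleCat.{u} R)) :
    β.prop R ((HomotopyCategory.quotient _ _).obj (threeTermComplex S)) := by
  have h₁ : ∃ a : ℤ, ∀ i < a, IsZero ((threeTermComplex S).X i) :=
    ⟨0, fun i hi => isZero_threeTermX S i (by lia) (by lia) (by lia)⟩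
  have h₂ : ∃ a : ℤ, ∀ i > a, IsZero ((threeTermComplex S).X i) :=
    ⟨2, fun i hi => isZero_threeTermX S i (by lia) (by lia) (by lia)⟩
  match β with
  | .blank => trivial
  | .plus => exact h₁
  | .minus => exact h₂
  | .b => exact ⟨h₁, h₂⟩

/-- If every `n`-exact complex is pure exact, then every `n`-exact sequence is pure exact. -/
lemma exists_lift_of_Kn_le_Kpe {n : ℕ∞} {β : Bound} (h : Kn R n β ≤ Kpe R β)
    {S : ShortComplex (ModuleCat.{u} R)} (hS : S.ShortExact)
    (hS' : ∀ M, finResLTSucc R n M → ∀ f : M ⟶ S.X₃, ∃ g : M ⟶ S.X₂, g ≫ S.g = f)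
    {M : ModuleCat.{u} R} (hM : finPresented R M) (f : M ⟶ S.X₃) :
    ∃ g : M ⟶ S.X₂, g ≫ S.g = f := by
  refine (relExactAt_threeTermComplex_iff (finPresented_self R) hS).1 ?_ M hM f
  exact h ⟨_, prop_threeTermComplex β S⟩
    ((relExactAt_threeTermComplex_iff (finResLTSucc_self R n) hS).2 hS')

/-- The truncation of a direct sum to finitely many coordinates factors through the finite subsum,
which stays in `𝒫^{<n+1}`. -/
lemma exists_finResLTSucc_of_finset {n : ℕ∞} {ι : Type u} [DecidableEq ι] (P : ι → Type u)
    [∀ i, AddCommGroup (P i)] [∀ i, Module R (P i)]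
    (hP : ∀ i, finResLTSucc R n (ModuleCat.of R (P i))) (s : Finset ι) :
    ∃ (C : ModuleCat.{u} R) (q : (Π₀ i, P i) →ₗ[R] C) (j : C →ₗ[R] (Π₀ i, P i)),
      finResLTSucc R n C ∧ ∀ x, j (q x) = ∑ i ∈ s, DFinsupp.single i (x i) := by
  induction s using Finset.induction_on with
  | empty =>
    exact ⟨ModuleCat.of R PUnit, 0, 0, ⟨0, by simp, .zero ⟨inferInstance, inferInstance⟩⟩,
      fun x => by simp⟩
  | insert a s ha ih =>
    obtain ⟨C, q, j, hC, h⟩ := ih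
    refine ⟨ModuleCat.of R (P a × C), (DFinsupp.lapply a).prod q,
      (DFinsupp.lsingle a).coprod j, finResLTSucc_prod (hP a) hC, fun x => ?_⟩
    rw [Finset.sum_insert ha, ← h]
    rfl

/-- Every module has an `n`-exact cover by a module whose finitely generated submodules factor
through modules of `𝒫^{< n+1}`, namely by a direct sum of such modules. -/
lemma exists_relative_cover (n : ℕ∞) (M : Type u) [AddCommGroup M] [Module R M] :
    ∃ (E : Type u) (_ : AddCommGroup E) (_ : Module R E) (π : E →ₗ[R] M),
      (∀ P : ModuleCat.{u} R, finResLTSucc R n P → ∀ f : P →ₗ[R] M,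
        ∃ g : P →ₗ[R] E, π ∘ₗ g = f) ∧
      ∀ (A : Type u) [AddCommGroup A] [Module R A] [Module.Finite R A] (t : A →ₗ[R] E),
        ∃ (C : ModuleCat.{u} R) (q : E →ₗ[R] C) (j : C →ₗ[R] E),
          finResLTSucc R n C ∧ ∀ a, j (q (t a)) = t a := by
  classical
  -- Quotients of the `R^m` represent all finitely generated modules up to isomorphism, so the pairs
  -- of a module in `𝒫^{<n+1}` and a map to `M` can be indexed within the universe `u`.
  let ι : Type u := Σ (m : ℕ) (N : Submodule R (Fin m → R)),
    {f : ((Fin m → R) ⧸ N) →ₗ[R] M // finResLTSucc R n (ModuleCat.of R ((Fin m → R) ⧸ N))}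
  let P : ι → Type u := fun i => (Fin i.1 → R) ⧸ i.2.1
  refine ⟨Π₀ i : ι, P i, inferInstance, inferInstance,
    DFinsupp.lsum ℕ (fun i : ι => i.2.2.1), ?_, ?_⟩
  · intro Q hQ f
    have : Module.Finite R Q := by
      obtain ⟨k, -, hk⟩ := hQ
      have : Module.FinitePresentation R Q := finPresented_of_hasResolution hk
      infer_instance
    obtain ⟨m, N, ⟨e⟩⟩ := Module.Finite.exists_fin_quot_equiv R Q
    obtain ⟨k, hk, hQ⟩ := hQ
    let i : ι := ⟨m, N, f ∘ₗ e.toLinearMap, k, hk, hQ.of_linearEquiv e.symm⟩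
    refine ⟨DFinsupp.lsingle (M := P) i ∘ₗ e.symm.toLinearMap, ?_⟩
    ext x
    simp [i]
  · intro A _ _ _ t
    obtain ⟨s, hs⟩ := Module.Finite.fg_top (R := R) (M := A)
    -- The coordinates that occur in the images of a finite generating set suffice.
    obtain ⟨C, q, j, hC, h⟩ := exists_finResLTSucc_of_finset P (fun i => i.2.2.2)
      (s.biUnion fun a => (t a).support)
    refine ⟨C, q, j, hC, fun a => ?_⟩
    suffices H : j ∘ₗ q ∘ₗ t = t from LinearMap.congr_fun H a
    refine LinearMap.ext_on hs fun a ha => ?_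
    change j (q (t a)) = t a
    rw [h]
    ext i : 1
    rw [DFinsupp.finsetSum_apply]
    by_cases hi : i ∈ s.biUnion fun a => (t a).support
    · rw [Finset.sum_eq_single_of_mem i hi]
      · simp
      · intro b _ hb
        exact DFinsupp.single_eq_of_ne hb.symm
    · have : t a i = 0 := by
        by_contra h'
        exact hi (Finset.mem_biUnion.2 ⟨a, ha, DFinsupp.mem_support_iff.2 h'⟩)
      rw [this]
      refine Finset.sum_eq_zero fun b hb => DFinsupp.single_eq_of_ne ?_
      rintro rfl
      exact hi hb

/-- If every `n`-exact complex is pure exact, then every finitely presented module is a direct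
summand of a module of `𝒫^{< n+1}`. -/
lemma exists_retract_of_Kn_le_Kpe {n : ℕ∞} {β : Bound} (h : Kn R n β ≤ Kpe R β)
    (M : Type u) [AddCommGroup M] [Module R M] [Module.FinitePresentation R M] :
    ∃ (C : ModuleCat.{u} R) (i : M →ₗ[R] C) (r : C →ₗ[R] M),
      finResLTSucc R n C ∧ r ∘ₗ i = LinearMap.id := by
  obtain ⟨E, _, _, π, h1, h2⟩ := exists_relative_cover (R := R) n M
  have hπ : Function.Surjective π := fun x => by
    obtain ⟨g, hg⟩ := h1 _ (finResLTSucc_self R n) (LinearMap.toSpanSingleton R M x)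
    exact ⟨g (1 : R), (LinearMap.congr_fun hg (1 : R)).trans (one_smul R x)⟩
  -- The kernel sequence of the cover is `n`-exact, hence pure exact, and the identity of `M` lifts
  -- to a section.
  obtain ⟨t, ht⟩ := exists_lift_of_Kn_le_Kpe h (LinearMap.shortExact_shortComplexKer hπ)
    (fun P hP f => by
      obtain ⟨g, hg⟩ := h1 P hP f.hom
      exact ⟨ModuleCat.ofHom g, ModuleCat.hom_ext hg⟩)
    (M := ModuleCat.of R M) ‹_› (𝟙 _)
  obtain ⟨C, q, j, hC, h3⟩ := h2 M t.hom
  refine ⟨C, q ∘ₗ t.hom, π ∘ₗ j, hC, ?_⟩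
  ext x
  exact (congr_arg π (h3 x)).trans (congr_arg (fun f => f.hom x) ht)

lemma projectiveDimension_lt_of_Kn_le_Kpe {n : ℕ∞} {β : Bound} (h : Kn R n β ≤ Kpe R β)
    (M : ModuleCat.{u} R) [Module.FinitePresentation R M] :
    projectiveDimension M < ((n + 1 : ℕ∞) : WithBot ℕ∞) := by
  obtain ⟨C, i, r, ⟨k, hk, hC⟩, hir⟩ := exists_retract_of_Kn_le_Kpe h M
  refine (projectiveDimension_lt_coe_succ_iff M n).2 ⟨k, hk, ?_⟩
  have := hC.hasProjectiveDimensionLT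
  exact Retract.hasProjectiveDimensionLT (Y := C)
    ⟨ModuleCat.ofHom i, ModuleCat.ofHom r, ModuleCat.hom_ext hir⟩ _

/-- The kernel of the composite is an extension of `ker r` by `ker g`. -/
lemma finitePresentation_ker_comp {M N L : Type u} [AddCommGroup M]
    [AddCommGroup N] [AddCommGroup L] [Module R M] [Module R N] [Module R L] (g : M →ₗ[R] N)
    (r : N →ₗ[R] L) (hg : Function.Surjective g) [Module.FinitePresentation R (LinearMap.ker g)]
    [Module.FinitePresentation R (LinearMap.ker r)] :
    Module.FinitePresentation R (LinearMap.ker (r ∘ₗ g)) := by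
  obtain ⟨Z, _, _, a, ha, ⟨e⟩, ⟨e'⟩⟩ : ∃ (Z : Type u) (_ : AddCommGroup Z) (_ : Module R Z)
      (a : Z →ₗ[R] LinearMap.ker r), Function.Surjective a ∧
        Nonempty (LinearMap.ker g ≃ₗ[R] LinearMap.ker a) ∧
        Nonempty (LinearMap.ker (r ∘ₗ g) ≃ₗ[R] Z) := by
    let a : LinearMap.ker (r ∘ₗ g) →ₗ[R] LinearMap.ker r := g.restrict fun x hx => hx
    refine ⟨_, inferInstance, inferInstance, a, ?_, ⟨?_⟩, ⟨.refl _ _⟩⟩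
    · rintro ⟨x, hx⟩
      obtain ⟨y, rfl⟩ := hg x
      exact ⟨⟨y, hx⟩, rfl⟩
    · exact
      { toFun x := ⟨⟨x.1, by simp⟩, Subtype.ext x.2⟩
        map_add' x y := rfl
        map_smul' c x := rfl
        invFun x := ⟨x.1.1, congr_arg Subtype.val x.2⟩
        left_inv x := rfl
        right_inv x := rfl }
  have : Module.FinitePresentation R (LinearMap.ker a) := .of_equiv e
  have : Module.FinitePresentation R Z := Module.finitePresentation_of_ker a ha
  exact .of_equiv e'.symm

/-- `R/I` is a retract of a module `C` with a resolution by finitely generated projectives. This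
yields a projective cover of `R/I` with finitely presented kernel, to be compared with `R → R/I`. -/
lemma leftCoherent_of_Kn_le_Kpe {n : ℕ∞} {β : Bound} (h : Kn R n β ≤ Kpe R β) :
    LeftCoherent R := by
  intro I hI
  have hI' : (LinearMap.ker I.mkQ).FG := by rwa [Submodule.ker_mkQ]
  have : Module.FinitePresentation R (R ⧸ I) :=
    Module.finitePresentation_of_surjective I.mkQ I.mkQ_surjective hI'
  obtain ⟨C, i, r, ⟨k, -, hC⟩, hir⟩ := exists_retract_of_Kn_le_Kpe h (R ⧸ I)
  have hr : Function.Surjective r := fun x => ⟨i x, LinearMap.congr_fun hir x⟩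
  have fpC : Module.FinitePresentation R C := finPresented_of_hasResolution hC
  have fpr : Module.FinitePresentation R (LinearMap.ker r) :=
    Module.finitePresentation_of_split_exact (LinearMap.ker r).subtype r i hir
      (Submodule.injective_subtype _) (LinearMap.exact_subtype_ker_map r)
  -- Lengthening the resolution provides a first step `K → F → C` even when `C` is itself
  -- projective.
  obtain _ | @⟨_, K, F, _, f, g, w, hS, ⟨_, _⟩, hK⟩ := hC.succ_of_fgProjective
  have hf := (ModuleCat.mono_iff_injective f).1 hS.mono_f
  have hg := (ModuleCat.epi_iff_surjective g).1 hS.epi_g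
  have hfg := (ShortComplex.ShortExact.moduleCat_exact_iff_function_exact _).1 hS.exact
  have fpK : Module.FinitePresentation R K := finPresented_of_hasResolution hK
  have : Module.FinitePresentation R (LinearMap.ker g.hom) := by
    rw [hfg.linearMap_ker_eq]
    exact .of_equiv (LinearEquiv.ofInjective f.hom hf)
  have : Module.FinitePresentation R (LinearMap.ker (r ∘ₗ g.hom)) :=
    finitePresentation_ker_comp g.hom r hg
  have := finitePresentation_ker_of_finitePresentation_ker (r ∘ₗ g.hom) I.mkQ (hr.comp hg)
    I.mkQ_surjective
  rwa [Submodule.ker_mkQ] at this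

end ThreeTermComplexes

/-! ### Balanced tensor products and character modules. -/

section BalancedTensorProducts

variable {R : Type u} [Ring R]

section API

variable {N N' N'' : Type u} [AddCommGroup N] [AddCommGroup N'] [AddCommGroup N'']
  [Module Rᵐᵒᵖ N] [Module Rᵐᵒᵖ N'] [Module Rᵐᵒᵖ N''] {M M' M'' : Type u} [AddCommGroup M]
  [AddCommGroup M'] [AddCommGroup M''] [Module R M] [Module R M'] [Module R M'']

variable (R) in
/-- The elementary tensors in `N ⊗_R M`. -/
def BalancedTensor.tmul (x : N) (m : M) : BalancedTensor R N M :=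
  QuotientAddGroup.mk (x ⊗ₜ[ℤ] m)

lemma BalancedTensor.smul_tmul (r : R) (x : N) (m : M) :
    tmul R (MulOpposite.op r • x) m = tmul R x (r • m) := by
  refine (QuotientAddGroup.eq_iff_sub_mem).2 (AddSubgroup.subset_closure ⟨r, x, m, rfl⟩)

lemma BalancedTensor.add_tmul (x y : N) (m : M) :
    tmul R (x + y) m = tmul R x m + tmul R y m :=
  congr_arg (QuotientAddGroup.mk' (balancedRelations R N M)) (TensorProduct.add_tmul x y m)

lemma BalancedTensor.tmul_add (x : N) (m m' : M) :
    tmul R x (m + m') = tmul R x m + tmul R x m' :=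
  congr_arg (QuotientAddGroup.mk' (balancedRelations R N M)) (TensorProduct.tmul_add x m m')

lemma BalancedTensor.zero_tmul (m : M) : tmul R (0 : N) m = 0 :=
  congr_arg (QuotientAddGroup.mk' (balancedRelations R N M)) (TensorProduct.zero_tmul N m)

lemma BalancedTensor.tmul_zero (x : N) : tmul R x (0 : M) = 0 :=
  congr_arg (QuotientAddGroup.mk' (balancedRelations R N M)) (TensorProduct.tmul_zero M x)

lemma BalancedTensor.sum_tmul {ι : Type*} (s : Finset ι) (x : ι → N) (m : M) :
    tmul R (∑ i ∈ s, x i) m = ∑ i ∈ s, tmul R (x i) m :=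
  map_sum (⟨⟨fun x => tmul R x m, zero_tmul m⟩, fun x y => add_tmul x y m⟩ :
    N →+ BalancedTensor R N M) x s

lemma BalancedTensor.tmul_sum {ι : Type*} (s : Finset ι) (x : N) (m : ι → M) :
    tmul R x (∑ i ∈ s, m i) = ∑ i ∈ s, tmul R x (m i) :=
  map_sum (⟨⟨fun m => tmul R x m, tmul_zero x⟩, fun m m' => tmul_add x m m'⟩ :
    M →+ BalancedTensor R N M) m s

lemma BalancedTensor.induction_on {motive : BalancedTensor R N M → Prop}
    (t : BalancedTensor R N M) (zero : motive 0) (tmul : ∀ x m, motive (tmul R x m))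
    (add : ∀ x y, motive x → motive y → motive (x + y)) : motive t := by
  obtain ⟨t, rfl⟩ := QuotientAddGroup.mk_surjective t
  induction t with
  | zero => exact zero
  | tmul x m => exact tmul x m
  | add x y hx hy => exact add _ _ hx hy

/-- The additive map on `N ⊗_R M` defined by a balanced biadditive map. -/
def BalancedTensor.lift {A : Type*} [AddCommGroup A] (φ : N →+ M →+ A)
    (hφ : ∀ (r : R) x m, φ (MulOpposite.op r • x) m = φ x (r • m)) :
    BalancedTensor R N M →+ A :=
  QuotientAddGroup.lift _ (TensorProduct.liftAddHom φ (fun r x m => by simp)) (by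
    rw [balancedRelations, AddSubgroup.closure_le]
    rintro _ ⟨r, x, m, rfl⟩
    simp [hφ])

@[simp]
lemma BalancedTensor.map_tmul (f : N →ₗ[Rᵐᵒᵖ] N') (x : N) (m : M) :
    map f M (tmul R x m) = tmul R (f x) m := rfl

lemma BalancedTensor.addMonoidHom_ext {A : Type*} [AddCommGroup A]
    {φ ψ : BalancedTensor R N M →+ A} (h : ∀ x m, φ (tmul R x m) = ψ (tmul R x m)) : φ = ψ := by
  refine DFunLike.ext _ _ fun t => ?_
  induction t using BalancedTensor.induction_on with
  | zero => simp
  | tmul x m => exact h x m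
  | add x y hx hy => simp [hx, hy]

variable (N) in
/-- The map `id ⊗ g : N ⊗_R M → N ⊗_R M'` induced by a map `g : M → M'` of left modules. -/
def BalancedTensor.lmap (g : M →ₗ[R] M') : BalancedTensor R N M →+ BalancedTensor R N M' :=
  lift (AddMonoidHom.mk' (fun x => AddMonoidHom.mk' (fun m => tmul R x (g m))
    (fun m m' => by rw [map_add, tmul_add])) (fun x y => by ext m; exact add_tmul x y _))
    (fun r x m => by simp [smul_tmul])

@[simp]
lemma BalancedTensor.lmap_tmul (g : M →ₗ[R] M') (x : N) (m : M) :
    lmap N g (tmul R x m) = tmul R x (g m) := rfl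

lemma BalancedTensor.lmap_comp (g : M →ₗ[R] M') (g' : M' →ₗ[R] M'') (t : BalancedTensor R N M) :
    lmap N (g' ∘ₗ g) t = lmap N g' (lmap N g t) := by
  have : lmap N (g' ∘ₗ g) = (lmap N g').comp (lmap N g) := addMonoidHom_ext fun _ _ => rfl
  rw [this, AddMonoidHom.comp_apply]

lemma BalancedTensor.map_comp (f : N →ₗ[Rᵐᵒᵖ] N') (f' : N' →ₗ[Rᵐᵒᵖ] N'')
    (t : BalancedTensor R N M) : map (f' ∘ₗ f) M t = map f' M (map f M t) := by
  have : map (f' ∘ₗ f) M = (map f' M).comp (map f M) := addMonoidHom_ext fun _ _ => rfl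
  rw [this, AddMonoidHom.comp_apply]

lemma BalancedTensor.map_lmap (f : N →ₗ[Rᵐᵒᵖ] N') (g : M →ₗ[R] M') (t : BalancedTensor R N M) :
    map f M' (lmap N g t) = lmap N' g (map f M t) := by
  have : (map f M').comp (lmap N g) = (lmap N' g).comp (map f M) :=
    addMonoidHom_ext fun _ _ => rfl
  exact DFunLike.congr_fun this t

end API

/-- The character group `Hom_ℤ(M, ℚ/ℤ)` of a left module, as a right module. -/
def RightDual (_R : Type u) (M : Type u) [AddCommGroup M] : Type u :=
  CharacterModule M

/-- The character group `Hom_ℤ(N, ℚ/ℤ)` of a right module, as a left module. -/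
def LeftDual (_R : Type u) (N : Type u) [AddCommGroup N] : Type u :=
  CharacterModule N

section Characters

variable {R M N : Type u} [AddCommGroup M] [AddCommGroup N]

instance : AddCommGroup (RightDual R M) := inferInstanceAs (AddCommGroup (CharacterModule M))

instance : AddCommGroup (LeftDual R N) := inferInstanceAs (AddCommGroup (CharacterModule N))

instance : FunLike (RightDual R M) M (AddCircle (1 : ℚ)) :=
  inferInstanceAs (FunLike (CharacterModule M) M _)

instance : FunLike (LeftDual R N) N (AddCircle (1 : ℚ)) :=
  inferInstanceAs (FunLike (CharacterModule N) N _)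

instance : AddMonoidHomClass (RightDual R M) M (AddCircle (1 : ℚ)) :=
  inferInstanceAs (AddMonoidHomClass (M →+ _) M _)

instance : AddMonoidHomClass (LeftDual R N) N (AddCircle (1 : ℚ)) :=
  inferInstanceAs (AddMonoidHomClass (N →+ _) N _)

@[ext]
lemma RightDual.ext {c d : RightDual R M} (h : ∀ m, c m = d m) : c = d := DFunLike.ext _ _ h

@[ext]
lemma LeftDual.ext {c d : LeftDual R N} (h : ∀ m, c m = d m) : c = d := DFunLike.ext _ _ h

@[simp]
lemma RightDual.add_apply (c d : RightDual R M) (m : M) : (c + d) m = c m + d m := rfl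

@[simp]
lemma LeftDual.add_apply (c d : LeftDual R N) (m : N) : (c + d) m = c m + d m := rfl

/-- The character with a given underlying map. -/
def RightDual.mk (R : Type u) (c : M →+ AddCircle (1 : ℚ)) : RightDual R M := c

/-- The character with a given underlying map. -/
def LeftDual.mk (R : Type u) (c : N →+ AddCircle (1 : ℚ)) : LeftDual R N := c

@[simp]
lemma RightDual.mk_apply (c : M →+ AddCircle (1 : ℚ)) (m : M) : RightDual.mk R c m = c m := rfl

@[simp]
lemma LeftDual.mk_apply (c : N →+ AddCircle (1 : ℚ)) (m : N) : LeftDual.mk R c m = c m := rfl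

end Characters

section Duals

variable {M M' : Type u} [AddCommGroup M] [AddCommGroup M'] [Module R M] [Module R M']
  {N N' N'' : Type u} [AddCommGroup N] [AddCommGroup N'] [AddCommGroup N'']
  [Module Rᵐᵒᵖ N] [Module Rᵐᵒᵖ N'] [Module Rᵐᵒᵖ N'']

instance : Module Rᵐᵒᵖ (RightDual R M) where
  smul r c := .mk R ((c : M →+ AddCircle (1 : ℚ)).comp (DistribSMul.toAddMonoidHom M r.unop))
  one_smul c := by ext m; exact congr_arg c (one_smul R m)
  mul_smul r s c := by ext m; exact congr_arg c (mul_smul s.unop r.unop m)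
  smul_zero r := rfl
  zero_smul c := by ext m; exact (congr_arg c (zero_smul R m)).trans (map_zero c)
  smul_add r c d := rfl
  add_smul r s c := by
    ext m; exact (congr_arg c (add_smul r.unop s.unop m)).trans (map_add c _ _)

@[simp]
lemma RightDual.smul_apply (r : Rᵐᵒᵖ) (c : RightDual R M) (m : M) : (r • c) m = c (r.unop • m) :=
  rfl

instance : Module R (LeftDual R N) where
  smul r c := .mk R ((c : N →+ AddCircle (1 : ℚ)).comp
    (DistribSMul.toAddMonoidHom N (MulOpposite.op r)))
  one_smul c := by ext m; exact congr_arg c (one_smul Rᵐᵒᵖ m)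
  mul_smul r s c := by ext m; exact congr_arg c (mul_smul (MulOpposite.op s) (MulOpposite.op r) m)
  smul_zero r := rfl
  zero_smul c := by ext m; exact (congr_arg c (zero_smul Rᵐᵒᵖ m)).trans (map_zero c)
  smul_add r c d := rfl
  add_smul r s c := by
    ext m
    exact (congr_arg c (add_smul (MulOpposite.op r) (MulOpposite.op s) m)).trans (map_add c _ _)

@[simp]
lemma LeftDual.smul_apply (r : R) (c : LeftDual R N) (m : N) :
    (r • c) m = c (MulOpposite.op r • m) := rfl

/-- The dual of a map of left modules. -/
def RightDual.map (f : M →ₗ[R] M') : RightDual R M' →ₗ[Rᵐᵒᵖ] RightDual R M where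
  toFun c := .mk R ((c : M' →+ AddCircle (1 : ℚ)).comp f.toAddMonoidHom)
  map_add' c d := rfl
  map_smul' r c := by ext m; exact congr_arg c (map_smul f r.unop m).symm

/-- The dual of a map of right modules. -/
def LeftDual.map (f : N →ₗ[Rᵐᵒᵖ] N') : LeftDual R N' →ₗ[R] LeftDual R N where
  toFun c := .mk R ((c : N' →+ AddCircle (1 : ℚ)).comp f.toAddMonoidHom)
  map_add' c d := rfl
  map_smul' r c := by ext m; exact congr_arg c (map_smul f (MulOpposite.op r) m).symm

lemma exists_addCircle_extension {A B : Type u} [AddCommGroup A] [AddCommGroup B] (f : A →+ B)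
    (hf : Function.Injective f) (c : A →+ AddCircle (1 : ℚ)) :
    ∃ d : B →+ AddCircle (1 : ℚ), ∀ a, d (f a) = c a := by
  obtain ⟨d, hd⟩ := CharacterModule.dual_surjective_of_injective f.toIntLinearMap hf c
  exact ⟨d, fun a => DFunLike.congr_fun hd a⟩

lemma exists_addCircle_ne_zero {A : Type u} [AddCommGroup A] {a : A} {B : AddSubgroup A}
    (ha : a ∉ B) : ∃ c : A →+ AddCircle (1 : ℚ), (∀ b ∈ B, c b = 0) ∧ c a ≠ 0 := by
  have h : (QuotientAddGroup.mk a : A ⧸ B) ≠ 0 := fun h => ha ((QuotientAddGroup.eq_zero_iff a).1 h)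
  obtain ⟨c, hc⟩ := CharacterModule.exists_character_apply_ne_zero_of_ne_zero h
  refine ⟨(c : (A ⧸ B) →+ AddCircle (1 : ℚ)).comp (QuotientAddGroup.mk' B), fun b hb => ?_, hc⟩
  have : (QuotientAddGroup.mk b : A ⧸ B) = 0 := (QuotientAddGroup.eq_zero_iff b).2 hb
  exact (congr_arg c this).trans (map_zero c)

/-- A map of right modules `N → Hom_ℤ(M, ℚ/ℤ)`, as a character of `N ⊗_R M`. -/
def uncurryDual (φ : N →ₗ[Rᵐᵒᵖ] RightDual R M) : BalancedTensor R N M →+ AddCircle (1 : ℚ) :=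
  BalancedTensor.lift (AddMonoidHom.mk' (fun x => ((φ x : RightDual R M) : M →+ _))
    (fun x y => by rw [map_add]; rfl))
    (fun r x m => DFunLike.congr_fun (map_smul φ (MulOpposite.op r) x) m)

/-- A character of `N ⊗_R M`, as a map of right modules `N → Hom_ℤ(M, ℚ/ℤ)`. -/
def curryDual (c : BalancedTensor R N M →+ AddCircle (1 : ℚ)) : N →ₗ[Rᵐᵒᵖ] RightDual R M where
  toFun x := .mk R (AddMonoidHom.mk' (fun m => c (.tmul R x m))
    (fun m m' => by rw [BalancedTensor.tmul_add, map_add]))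
  map_add' x y := by ext m; simp [BalancedTensor.add_tmul]
  map_smul' r x := by
    ext m
    exact congr_arg c (BalancedTensor.smul_tmul r.unop x m)

/-- A left module is flat if and only if its character module is an injective right module. -/
lemma flat_iff_injective_rightDual (M : ModuleCat.{u} R) :
    flat R M ↔ Module.Injective Rᵐᵒᵖ (RightDual R M) := by
  constructor
  · intro h
    refine ⟨fun N N' _ _ _ _ f hf g => ?_⟩
    obtain ⟨d, hd⟩ := exists_addCircle_extension _ (h N N' f hf) (uncurryDual g)
    refine ⟨curryDual d, fun x => ?_⟩
    ext m
    exact hd (.tmul R x m)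
  · intro h N N' _ _ _ _ f hf
    rw [injective_iff_map_eq_zero]
    intro t ht
    by_contra h0
    obtain ⟨c, -, hc⟩ := exists_addCircle_ne_zero (B := ⊥) (a := t) h0
    -- A character that detects `t` extends along `f ⊗ M` by injectivity, so it would vanish on `t`.
    obtain ⟨ψ, hψ⟩ := h.out f hf (curryDual c)
    have : (uncurryDual ψ).comp (BalancedTensor.map f M) = c :=
      BalancedTensor.addMonoidHom_ext fun x m => DFunLike.congr_fun (hψ x) m
    rw [← this, AddMonoidHom.comp_apply, ht, map_zero] at hc
    exact hc rfl

/-- Maps `N → Hom(P, ℚ/ℤ)` correspond to maps `P → Hom(N, ℚ/ℤ)`. Since `ℚ/ℤ` is divisible,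
restriction of characters along `N ⊆ N'` is surjective, and projectivity of `P` supplies the lift.
-/
lemma injective_rightDual_of_projective (P : Type u) [AddCommGroup P] [Module R P]
    [Module.Projective R P] : Module.Injective Rᵐᵒᵖ (RightDual R P) := by
  refine ⟨fun N N' _ _ _ _ f hf g => ?_⟩
  let g' : P →ₗ[R] LeftDual R N :=
    { toFun p := .mk R (AddMonoidHom.mk' (fun x => g x p) (fun x y => by simp))
      map_add' p q := by ext x; simp
      map_smul' r p := by ext x; simp }
  have hs : Function.Surjective (LeftDual.map (R := R) f) := fun c => by
    obtain ⟨d, hd⟩ := exists_addCircle_extension f.toAddMonoidHom hf c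
    exact ⟨.mk R d, LeftDual.ext hd⟩
  obtain ⟨h, hh⟩ := Module.projective_lifting_property _ g' hs
  refine ⟨{ toFun x := .mk R (AddMonoidHom.mk' (fun p => h p x) (fun p q => by simp))
            map_add' x y := by ext p; simp
            map_smul' r x := by ext p; simp }, fun x => ?_⟩
  ext p
  exact DFunLike.congr_fun (LinearMap.congr_fun hh p) x

lemma flat_of_projective (P : Type u) [AddCommGroup P] [Module R P]
    [Module.Projective R P] : flat R (ModuleCat.of R P) :=
  (flat_iff_injective_rightDual _).2 (injective_rightDual_of_projective P)

lemma rightDual_map_injective (g : M →ₗ[R] M') (hg : Function.Surjective g) :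
    Function.Injective (RightDual.map g) := fun c d h => by
  ext m
  obtain ⟨m, rfl⟩ := hg m
  exact DFunLike.congr_fun h m

lemma rightDual_map_surjective (g : M →ₗ[R] M') (hg : Function.Injective g) :
    Function.Surjective (RightDual.map g) := fun c => by
  obtain ⟨d, hd⟩ := exists_addCircle_extension g.toAddMonoidHom hg c
  exact ⟨.mk R d, RightDual.ext hd⟩

lemma rightDual_map_exact {M'' : Type u} [AddCommGroup M''] [Module R M''] (f : M →ₗ[R] M')
    (g : M' →ₗ[R] M'') (hfg : Function.Exact f g) (hg : Function.Surjective g) :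
    Function.Exact (RightDual.map g) (RightDual.map f) := by
  intro c
  constructor
  · intro h
    have hle : g.toAddMonoidHom.ker ≤ (c : M' →+ AddCircle (1 : ℚ)).ker := fun x hx => by
      obtain ⟨y, rfl⟩ := (hfg x).1 hx
      exact DFunLike.congr_fun h y
    refine ⟨.mk R (g.toAddMonoidHom.liftOfSurjective hg ⟨c, hle⟩), ?_⟩
    ext m
    exact g.toAddMonoidHom.liftOfRightInverse_comp_apply _ (Function.rightInverse_surjInv hg)
      ⟨c, hle⟩ m
  · rintro ⟨d, rfl⟩
    ext m
    exact (congr_arg d (hfg.apply_apply_eq_zero m)).trans (map_zero d)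

lemma shortExact_rightDual {M'' : Type u} [AddCommGroup M''] [Module R M''] (f : M →ₗ[R] M')
    (g : M' →ₗ[R] M'') (hf : Function.Injective f) (hfg : Function.Exact f g)
    (hg : Function.Surjective g) :
    (ShortComplex.mk (ModuleCat.ofHom (RightDual.map g)) (ModuleCat.ofHom (RightDual.map f))
      (ModuleCat.hom_ext (LinearMap.ext
        (rightDual_map_exact f g hfg hg).apply_apply_eq_zero))).ShortExact :=
  ModuleCat.shortComplex_shortExact _ (rightDual_map_exact f g hfg hg)
    (rightDual_map_injective g hg) (rightDual_map_surjective f hf)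

/-- Right exactness of `- ⊗_R M`. -/
lemma BalancedTensor.map_exact (f : N →ₗ[Rᵐᵒᵖ] N') (g : N' →ₗ[Rᵐᵒᵖ] N'')
    (hfg : Function.Exact f g) (hg : Function.Surjective g) (t : BalancedTensor R N' M)
    (ht : map g M t = 0) : ∃ s, map f M s = t := by
  by_contra h
  -- A character that vanishes on the image of `f ⊗ M` curries to a map killing `ker g`. It
  -- therefore factors through `g ⊗ M` and vanishes on `t`.
  obtain ⟨c, hc, hct⟩ := exists_addCircle_ne_zero (B := (map f M).range) (a := t) h
  have hle : LinearMap.ker g ≤ LinearMap.ker (curryDual c) := fun x hx => by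
    obtain ⟨y, rfl⟩ := (hfg x).1 hx
    ext m
    exact hc _ ⟨tmul R y m, rfl⟩
  let φ : N'' →ₗ[Rᵐᵒᵖ] RightDual R M :=
    (LinearMap.ker g).liftQ (curryDual c) hle ∘ₗ
      (g.quotKerEquivOfSurjective hg).symm.toLinearMap
  have hφ : ∀ x, φ (g x) = curryDual c x := fun x => by
    simp only [φ, LinearMap.comp_apply, LinearEquiv.coe_coe]
    rw [show (g.quotKerEquivOfSurjective hg).symm (g x) = (LinearMap.ker g).mkQ x from
      (LinearEquiv.symm_apply_eq _).2 rfl]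
    rfl
  have : (uncurryDual φ).comp (map g M) = c :=
    addMonoidHom_ext fun x m => DFunLike.congr_fun (hφ x) m
  rw [← this, AddMonoidHom.comp_apply, ht, map_zero] at hct
  exact hct rfl

/-- Right exactness of `N ⊗_R -`. -/
lemma BalancedTensor.lmap_exact {M'' : Type u} [AddCommGroup M''] [Module R M'']
    (f : M →ₗ[R] M') (g : M' →ₗ[R] M'') (hfg : Function.Exact f g) (hg : Function.Surjective g)
    (t : BalancedTensor R N M') (ht : lmap N g t = 0) : ∃ s, lmap N f s = t := by
  by_contra h
  obtain ⟨c, hc, hct⟩ := exists_addCircle_ne_zero (B := (lmap N f).range) (a := t) h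
  -- For each `x` the character `c (x ⊗ -)` vanishes on the image of `f`, so it descends to `M''`;
  -- uniqueness makes the choice linear in `x`.
  have hφ : ∀ x, ∃ d : RightDual R M'', RightDual.map g d = curryDual c x := fun x =>
    (rightDual_map_exact f g hfg hg _).1 (by ext m; exact hc _ ⟨tmul R x m, rfl⟩)
  choose φ hφ using hφ
  have hinj := rightDual_map_injective g hg
  let φ' : N →ₗ[Rᵐᵒᵖ] RightDual R M'' :=
    { toFun := φ
      map_add' x y := hinj (by simp [hφ])
      map_smul' r x := hinj (by simp [hφ]) }
  have : (uncurryDual φ').comp (lmap N g) = c :=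
    addMonoidHom_ext fun x m => DFunLike.congr_fun (hφ x) m
  rw [← this, AddMonoidHom.comp_apply, ht, map_zero] at hct
  exact hct rfl

/-- Dualizing reverses the short exact sequences and makes the flat terms injective. -/
lemma HasResolution.hasInjectiveDimensionLT_rightDual {k : ℕ} {M : ModuleCat.{u} R}
    (h : HasResolution (flat R) k M) :
    HasInjectiveDimensionLT (ModuleCat.of Rᵐᵒᵖ (RightDual R M)) (k + 1) := by
  induction h with
  | @zero M hM =>
    have := (flat_iff_injective_rightDual M).1 hM
    have := Module.injective_object_of_injective_module Rᵐᵒᵖ (RightDual R M)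
    infer_instance
  | @succ k K P M f g w hS hP hK ih =>
    have := (flat_iff_injective_rightDual P).1 hP
    have := Module.injective_object_of_injective_module Rᵐᵒᵖ (RightDual R P)
    exact (shortExact_rightDual f.hom g.hom ((ModuleCat.mono_iff_injective f).1 hS.mono_f)
      ((ShortComplex.ShortExact.moduleCat_exact_iff_function_exact _).1 hS.exact)
      ((ModuleCat.epi_iff_surjective g).1 hS.epi_g)).hasInjectiveDimensionLT_X₁ (k + 1) ih
      inferInstance

end Duals

end BalancedTensorProducts

/-! ### Flatness of finitely presented modules, and a factorization criterion. -/

section FlatModules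

variable {R : Type u} [Ring R]

/-- Evaluation at the `j`-th coordinate `R^m ⊗_R K → K`. -/
def BalancedTensor.evalFin {m : ℕ} (K : Type u) [AddCommGroup K] [Module R K] (j : Fin m) :
    BalancedTensor R (Fin m → R) K →+ K :=
  lift (AddMonoidHom.mk' (fun x => AddMonoidHom.mk' (fun k => x j • k)
    (fun k k' => smul_add _ k k')) (fun x y => by ext k; exact add_smul (x j) (y j) k))
    (fun r x k => by simp [mul_smul])

@[simp]
lemma BalancedTensor.evalFin_tmul {m : ℕ} {K : Type u} [AddCommGroup K] [Module R K] (j : Fin m)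
    (x : Fin m → R) (k : K) : evalFin K j (tmul R x k) = x j • k := rfl

/-- Finitely presented flat modules are projective. -/
lemma projective_of_flat (K : Type u) [AddCommGroup K] [Module R K]
    [Module.FinitePresentation R K] (hK : flat R (ModuleCat.of R K)) : Module.Projective R K := by
  obtain ⟨m, s, π, u, hπ, hu⟩ := Module.FinitePresentation.exists_fin' R K
  -- `U` is the transpose of the relation matrix, so `ker U` represents `Hom(K, R)`. The tensor `t`
  -- below represents `π` itself, as an element of `R^m ⊗ K = K^m`; the relations say that `U` kills
  -- it.
  let U : (Fin m → R) →ₗ[Rᵐᵒᵖ] (Fin s → R) :=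
    { toFun x i := ∑ j, u (Pi.single i 1) j * x j
      map_add' x y := by ext i; simp [mul_add, Finset.sum_add_distrib]
      map_smul' r x := by ext i; simp [Finset.sum_mul, mul_assoc] }
  let ε : Fin m → Fin m → R := fun j => Pi.single j 1
  let t : BalancedTensor R (Fin m → R) K := ∑ j, .tmul R (ε j) (π (ε j))
  have hsum : ∀ x : Fin m → R, ∑ j, x j • π (ε j) = π x := fun x => by
    conv_rhs => rw [pi_eq_sum_univ' x, map_sum]
    refine Finset.sum_congr rfl fun j _ => ?_
    rw [map_smul]
  have hU : BalancedTensor.map U K t = 0 := by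
    have h1 : ∀ j, U (ε j) = ∑ i, MulOpposite.op (u (Pi.single i 1) j) •
        (Pi.single i 1 : Fin s → R) := fun j => by
      ext i
      simp [U, ε, Pi.single_apply]
    have h2 : BalancedTensor.map U K t =
        ∑ i, .tmul R (Pi.single i 1 : Fin s → R) (π (u (Pi.single i 1))) := by
      simp only [t, map_sum, BalancedTensor.map_tmul, h1, BalancedTensor.sum_tmul,
        BalancedTensor.smul_tmul]
      rw [Finset.sum_comm]
      refine Finset.sum_congr rfl fun i _ => ?_
      rw [← BalancedTensor.tmul_sum, hsum]
    rw [h2]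
    refine Finset.sum_eq_zero fun i _ => ?_
    rw [hu.apply_apply_eq_zero, BalancedTensor.tmul_zero]
  -- Flatness for `range U ⊆ R^s`, followed by right exactness, places `t` in the image of `ker U ⊗
  -- K`.
  have hU' : BalancedTensor.map U.rangeRestrict K t = 0 := by
    refine hK _ _ (LinearMap.range U).subtype (Submodule.injective_subtype _) ?_
    rw [map_zero]
    exact (BalancedTensor.map_comp _ _ t).symm.trans hU
  obtain ⟨y, hy⟩ := BalancedTensor.map_exact (LinearMap.ker U).subtype U.rangeRestrict
    (fun x => by
      have : U.rangeRestrict x = 0 ↔ U x = 0 := by rw [Subtype.ext_iff]; rfl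
      rw [this]
      simp) U.surjective_rangeRestrict t hU'
  -- An element of `Hom(K, R) ⊗ K` defines an endomorphism of `K` factoring through a projective
  -- module; for the preimage of `t` it is the identity.
  have key : ∀ y : BalancedTensor R (LinearMap.ker U) K, ∃ (F : Type u) (_ : AddCommGroup F)
      (_ : Module R F) (_ : Module.Projective R F) (a : K →ₗ[R] F) (b : F →ₗ[R] K), ∀ j,
      b (a (π (ε j))) = BalancedTensor.evalFin K j
        (BalancedTensor.map (LinearMap.ker U).subtype K y) := by
    intro y
    induction y using BalancedTensor.induction_on with
    | zero => exact ⟨PUnit, inferInstance, inferInstance, inferInstance, 0, 0, fun j => by simp⟩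
    | add y z hy hz =>
      obtain ⟨F, _, _, _, a, b, h⟩ := hy
      obtain ⟨F', _, _, _, a', b', h'⟩ := hz
      exact ⟨F × F', inferInstance, inferInstance, inferInstance, a.prod a', b.coprod b',
        fun j => by simp [h, h']⟩
    | tmul n k =>
      let a : (Fin m → R) →ₗ[R] R := ∑ j, (LinearMap.toSpanSingleton R R (n.1 j)) ∘ₗ
        LinearMap.proj j
      have ha : ∀ x, a x = ∑ j, x j * n.1 j := fun x => by simp [a]
      have hle : LinearMap.ker π ≤ LinearMap.ker a := by
        rw [hu.linearMap_ker_eq]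
        rintro _ ⟨x, rfl⟩
        have : a ∘ₗ u = 0 := by
          refine LinearMap.pi_ext' fun i => LinearMap.ext_ring ?_
          have : ∑ j, u (Pi.single i 1) j * n.1 j = 0 := congr_fun n.2 i
          simpa [ha] using this
        exact LinearMap.congr_fun this x
      let a' : K →ₗ[R] R := (LinearMap.ker π).liftQ a hle ∘ₗ
        (π.quotKerEquivOfSurjective hπ).symm.toLinearMap
      have ha' : ∀ x, a' (π x) = a x := fun x => by
        simp only [a', LinearMap.comp_apply, LinearEquiv.coe_coe]
        rw [show (π.quotKerEquivOfSurjective hπ).symm (π x) = (LinearMap.ker π).mkQ x from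
          (LinearEquiv.symm_apply_eq _).2 rfl]
        rfl
      refine ⟨R, inferInstance, inferInstance, inferInstance, a',
        LinearMap.toSpanSingleton R K k, fun j => ?_⟩
      simp [ha', ha, ε, Pi.single_apply]
  obtain ⟨F, _, _, _, a, b, h⟩ := key y
  refine Module.Projective.of_split a b ?_
  have hπ' : (b ∘ₗ a) ∘ₗ π = π := by
    refine LinearMap.pi_ext' fun j => LinearMap.ext_ring ?_
    have h1 := h j
    rw [hy] at h1
    refine h1.trans ?_
    simp only [t, map_sum, BalancedTensor.evalFin_tmul]
    rw [Finset.sum_eq_single j]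
    · simp [ε]
    · intro i _ hi
      simp [ε, hi.symm]
    · simp
  ext x
  obtain ⟨x, rfl⟩ := hπ x
  exact LinearMap.congr_fun hπ' x

/-- Over a left coherent ring, the projective dimension of a finitely presented module is at most
the injective dimension of its character module. -/
lemma LeftCoherent.hasProjectiveDimensionLT (hR : LeftCoherent R) (k : ℕ) (M : Type u)
    [AddCommGroup M] [Module R M] [Module.FinitePresentation R M]
    (h : HasInjectiveDimensionLT (ModuleCat.of Rᵐᵒᵖ (RightDual R M)) (k + 1)) :
    HasProjectiveDimensionLT (ModuleCat.of R M) (k + 1) := by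
  induction k generalizing M with
  | zero =>
    have h1 := injective_iff_hasInjectiveDimensionLT_one.2 h
    have h2 := Module.injective_module_of_injective_object Rᵐᵒᵖ (RightDual R M)
    have := projective_of_flat M ((flat_iff_injective_rightDual (ModuleCat.of R M)).2 h2)
    exact projective_iff_hasProjectiveDimensionLT_one.1 ((IsProjective.iff_projective M).1 this)
  | succ k ih =>
    obtain ⟨m, f, hf⟩ := Module.Finite.exists_fin' R M
    have := hR.finitePresentation_ker f hf
    have := injective_rightDual_of_projective (R := R) (Fin m → R)
    have := Module.injective_object_of_injective_module Rᵐᵒᵖ (RightDual R (Fin m → R))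
    -- The dual sequence has an injective middle term, so the character module of the syzygy has its
    -- dimension bound lowered by one.
    have hK := ih (LinearMap.ker f) ((shortExact_rightDual (LinearMap.ker f).subtype f
      (Submodule.injective_subtype _) (LinearMap.exact_subtype_ker_map f)
      hf).hasInjectiveDimensionLT_X₃ (k + 1) inferInstance h)
    exact (LinearMap.shortExact_shortComplexKer hf).hasProjectiveDimensionLT_X₃ (k + 1) hK
      inferInstance

/-- A criterion for flatness. The relations in `K` are those of the canonical presentation of `K` by
a free module. -/
lemma flat_of_forall_exists_factorization (K : Type u) [AddCommGroup K] [Module R K]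
    (h : ∀ L : Submodule R (K →₀ R), L.FG →
      L ≤ LinearMap.ker (Finsupp.linearCombination R (id : K → K)) →
      ∃ (Q : Type u) (_ : AddCommGroup Q) (_ : Module R Q) (_ : Module.Projective R Q)
        (a : (K →₀ R) →ₗ[R] Q) (b : Q →ₗ[R] K),
        b ∘ₗ a = Finsupp.linearCombination R (id : K → K) ∧ L ≤ LinearMap.ker a) :
    flat R (ModuleCat.of R K) := by
  intro N N' _ _ _ _ f hf
  let π : (K →₀ R) →ₗ[R] K := Finsupp.linearCombination R (id : K → K)
  have hπ : Function.Surjective π := Finsupp.linearCombination_id_surjective R K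
  have hs : ∀ t : BalancedTensor R N K, ∃ t₀, BalancedTensor.lmap N π t₀ = t := by
    intro t
    induction t using BalancedTensor.induction_on with
    | zero => exact ⟨0, map_zero _⟩
    | tmul x k =>
      obtain ⟨y, rfl⟩ := hπ k
      exact ⟨.tmul R x y, rfl⟩
    | add x y hx hy =>
      obtain ⟨x, rfl⟩ := hx
      obtain ⟨y, rfl⟩ := hy
      exact ⟨x + y, map_add _ _ _⟩
  -- A tensor involves only finitely many relations; `L` is their span.
  have key : ∀ y : BalancedTensor R N' (LinearMap.ker π), ∃ L : Submodule R (K →₀ R), L.FG ∧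
      L ≤ LinearMap.ker π ∧ ∀ (Q : Type u) [AddCommGroup Q] [Module R Q] (a : (K →₀ R) →ₗ[R] Q),
      L ≤ LinearMap.ker a →
        BalancedTensor.lmap N' a (BalancedTensor.lmap N' (LinearMap.ker π).subtype y) = 0 := by
    intro y
    induction y using BalancedTensor.induction_on with
    | zero => exact ⟨⊥, Submodule.fg_bot, bot_le, by simp⟩
    | tmul x l =>
      refine ⟨Submodule.span R {l.1}, Submodule.fg_span_singleton _, ?_, fun Q _ _ a ha => ?_⟩
      · simp [Submodule.span_le]
      · have : a l.1 = 0 := ha (Submodule.mem_span_singleton_self _)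
        simp [this, BalancedTensor.tmul_zero]
    | add y z hy hz =>
      obtain ⟨L, h1, h2, h3⟩ := hy
      obtain ⟨L', h1', h2', h3'⟩ := hz
      refine ⟨L ⊔ L', h1.sup h1', sup_le h2 h2', fun Q _ _ a ha => ?_⟩
      rw [map_add, map_add, h3 Q a (le_sup_left.trans ha), h3' Q a (le_sup_right.trans ha),
        add_zero]
  rw [injective_iff_map_eq_zero]
  intro t ht
  obtain ⟨t₀, rfl⟩ := hs t
  rw [BalancedTensor.map_lmap] at ht
  obtain ⟨y, hy⟩ := BalancedTensor.lmap_exact (M := LinearMap.ker π) (M' := K →₀ R)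
    (LinearMap.ker π).subtype π
    (LinearMap.exact_subtype_ker_map π) hπ _ ht
  obtain ⟨L, h1, h2, h3⟩ := key y
  obtain ⟨Q, _, _, _, a, b, hab, ha⟩ := h L h1 h2
  have h4 := h3 Q a ha
  rw [hy, ← BalancedTensor.map_lmap] at h4
  have h5 : BalancedTensor.lmap N a t₀ = 0 :=
    -- The image of `t₀` vanishes in `N' ⊗ Q`, hence in `N ⊗ Q` as `Q` is flat. Applying `b` then
    -- kills `t`.
    flat_of_projective Q N N' f hf (h4.trans (map_zero _).symm)
  have h6 : π = b ∘ₗ a := hab.symm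
  rw [h6, BalancedTensor.lmap_comp, h5, map_zero]

end FlatModules

/-! ### Weak global dimension over a coherent ring. -/

section WeakDimension

variable {R : Type u} [Ring R]

/-- Every map to `M` from a finitely presented module factors through a finitely presented module
of projective dimension at most `k`. -/
def FactorsThroughPD (R : Type u) [Ring R] (k : ℕ) (M : Type u) [AddCommGroup M] [Module R M] :
    Prop :=
  ∀ (A : Type u) [AddCommGroup A] [Module R A] [Module.FinitePresentation R A] (f : A →ₗ[R] M),
    ∃ C : ModuleCat.{u} R, Module.FinitePresentation R C ∧ HasProjectiveDimensionLT C (k + 1) ∧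
      ∃ (g : A →ₗ[R] C) (h : C →ₗ[R] M), h ∘ₗ g = f

/-- The image of a finitely generated module involves only finitely many basis elements; `r`
restricts to these and `e` extends by zero. -/
lemma exists_finset_finsupp_restriction {X A : Type u} [AddCommMonoid A] [Module R A]
    [Module.Finite R A] (f : A →ₗ[R] (X →₀ R)) :
    ∃ (m : ℕ) (r : (X →₀ R) →ₗ[R] (Fin m → R)) (e : (Fin m → R) →ₗ[R] (X →₀ R)),
      e ∘ₗ r ∘ₗ f = f := by
  classical
  obtain ⟨s, hs⟩ := Module.Finite.fg_top (R := R) (M := A)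
  let S : Finset X := s.biUnion fun a => (f a).support
  let φ := S.equivFin
  let r : (X →₀ R) →ₗ[R] (Fin S.card → R) := LinearMap.pi fun i => Finsupp.lapply (φ.symm i).1
  let e : (Fin S.card → R) →ₗ[R] (X →₀ R) :=
    ∑ i, Finsupp.lsingle (φ.symm i).1 ∘ₗ LinearMap.proj i
  have he : ∀ x, e (r x) = ∑ i ∈ S, Finsupp.single i (x i) := fun x => by
    simp only [e, r, LinearMap.sum_apply, LinearMap.comp_apply, LinearMap.proj_apply,
      LinearMap.pi_apply, Finsupp.lsingle_apply, Finsupp.lapply_apply]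
    rw [← Finset.sum_coe_sort S]
    exact Equiv.sum_comp φ.symm (fun i : S => Finsupp.single i.1 (x i.1))
  refine ⟨S.card, r, e, LinearMap.ext_on hs fun a ha => ?_⟩
  change e (r (f a)) = f a
  have hsub : (f a).support ⊆ S := Finset.subset_biUnion_of_mem (fun a => (f a).support) ha
  rw [he, ← Finset.sum_subset hsub]
  · exact Finsupp.sum_single (f a)
  · intro i _ hi
    rw [Finsupp.notMem_support_iff.1 hi, Finsupp.single_zero]

/-- Modules such that every map from a finitely presented module factors through a finitely
generated projective module are flat. -/
lemma FactorsThroughPD.flat {K : Type u} [AddCommGroup K] [Module R K]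
    (h : FactorsThroughPD R 0 K) : flat R (ModuleCat.of R K) := by
  refine flat_of_forall_exists_factorization K fun L hL hL' => ?_
  let π : (K →₀ R) →ₗ[R] K := Finsupp.linearCombination R (id : K → K)
  have : Module.Finite R L := .of_fg hL
  obtain ⟨m, r, e, her⟩ := exists_finset_finsupp_restriction L.subtype
  have her' : ∀ l ∈ L, e (r l) = l := fun l hl => LinearMap.congr_fun her ⟨l, hl⟩
  let U : Submodule R (Fin m → R) := L.map r
  have hU : (LinearMap.ker U.mkQ).FG := by
    rw [Submodule.ker_mkQ]
    exact hL.map r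
  have := Module.finitePresentation_of_surjective U.mkQ U.mkQ_surjective hU
  obtain ⟨C, -, hC, g, q, hq⟩ := h ((Fin m → R) ⧸ U) (U.liftQ (π ∘ₗ e) (by
    rintro _ ⟨l, hl, rfl⟩
    change π (e (r l)) = 0
    rw [her' l hl]
    exact hL' hl))
  have : Module.Projective R C :=
    (IsProjective.iff_projective C).2 (projective_iff_hasProjectiveDimensionLT_one.2 hC)
  -- The second component `x - e (r x)` accounts for the coordinates outside the finite set, and
  -- vanishes on `L`.
  refine ⟨C × (K →₀ R), inferInstance, inferInstance, inferInstance,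
    (g ∘ₗ U.mkQ ∘ₗ r).prod (LinearMap.id - e ∘ₗ r), q.coprod π, ?_, ?_⟩
  · refine LinearMap.ext fun x => ?_
    have : q (g (U.mkQ (r x))) = π (e (r x)) := LinearMap.congr_fun hq _
    change q (g (U.mkQ (r x))) + π (x - e (r x)) = π x
    rw [this, map_sub]
    abel
  · intro l hl
    have h1 : U.mkQ (r l) = 0 := (Submodule.Quotient.mk_eq_zero U).2 ⟨l, hl, rfl⟩
    refine Prod.ext ?_ ?_
    · exact (congr_arg g h1).trans (map_zero g)
    · exact sub_eq_zero.2 (her' l hl).symm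

/-- Dimension shifting along the canonical free presentation of a module. -/
lemma FactorsThroughPD.ker (hR : LeftCoherent R) {k : ℕ} {M : Type u} [AddCommGroup M]
    [Module R M] (h : FactorsThroughPD R (k + 1) M) :
    FactorsThroughPD R k (LinearMap.ker (Finsupp.linearCombination R (id : M → M))) := by
  intro A _ _ _ f
  let ψ : (M →₀ R) →ₗ[R] M := Finsupp.linearCombination R (id : M → M)
  obtain ⟨m, r, e, her⟩ := exists_finset_finsupp_restriction ((LinearMap.ker ψ).subtype ∘ₗ f)
  have her' : ∀ a, e (r (f a).1) = (f a).1 := fun a => LinearMap.congr_fun her a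
  let f' : A →ₗ[R] (Fin m → R) := r ∘ₗ (LinearMap.ker ψ).subtype ∘ₗ f
  let U : Submodule R (Fin m → R) := LinearMap.range f'
  have hU : (LinearMap.ker U.mkQ).FG := by
    rw [Submodule.ker_mkQ]
    exact Submodule.fg_range f'
  have := Module.finitePresentation_of_surjective U.mkQ U.mkQ_surjective hU
  obtain ⟨C, _, hC, g, q, hq⟩ := h ((Fin m → R) ⧸ U) (U.liftQ (ψ ∘ₗ e) (by
    rintro _ ⟨a, rfl⟩
    change ψ (e (r (f a).1)) = 0
    rw [her']
    exact (f a).2))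
  obtain ⟨l, γ, hγ⟩ := Module.Finite.exists_fin' R C
  -- The cover `γ` is added to make `σ` surjective. With this lift `δ`, `ψ ∘ (e + δ) = q ∘ σ`, so `e
  -- + δ` sends `ker σ` to `ker ψ`, and `ker σ` is the required intermediate module.
  obtain ⟨δ, hδ⟩ := Module.projective_lifting_property ψ (q ∘ₗ γ)
    (Finsupp.linearCombination_id_surjective R M)
  let σ : (Fin m → R) × (Fin l → R) →ₗ[R] C := (g ∘ₗ U.mkQ).coprod γ
  have hσ : Function.Surjective σ := fun c => by
    obtain ⟨x, rfl⟩ := hγ c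
    exact ⟨(0, x), by simp [σ]⟩
  have := hR.finitePresentation_ker γ hγ
  have hfp := finitePresentation_ker_of_finitePresentation_ker γ σ hγ hσ
  have hproj : Projective (ModuleCat.of R ((Fin m → R) × (Fin l → R))) :=
    (IsProjective.iff_projective _).1 inferInstance
  refine ⟨ModuleCat.of R (LinearMap.ker σ), hfp,
    (LinearMap.shortExact_shortComplexKer hσ).hasProjectiveDimensionLT_X₁ (k + 1)
      inferInstance hC, LinearMap.codRestrict _ (f'.prod 0) fun a => ?_,
    LinearMap.codRestrict _ (e.coprod δ ∘ₗ (LinearMap.ker σ).subtype) fun x => ?_, ?_⟩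
  · have h1 : U.mkQ (f' a) = 0 := (Submodule.Quotient.mk_eq_zero U).2 ⟨a, rfl⟩
    change g (U.mkQ (f' a)) + γ 0 = 0
    rw [h1, map_zero, map_zero, add_zero]
  · have h1 : q (g (U.mkQ x.1.1)) = ψ (e x.1.1) := LinearMap.congr_fun hq _
    have h2 : ψ (δ x.1.2) = q (γ x.1.2) := LinearMap.congr_fun hδ _
    have h3 : g (U.mkQ x.1.1) + γ x.1.2 = 0 := x.2
    change ψ (e x.1.1 + δ x.1.2) = 0
    rw [map_add, ← h1, h2, ← map_add, h3, map_zero]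
  · refine LinearMap.ext fun a => Subtype.ext ?_
    change e (r (f a).1) + δ 0 = (f a).1
    rw [her', map_zero, add_zero]

lemma FactorsThroughPD.hasResolution (hR : LeftCoherent R) {k : ℕ} {M : Type u}
    [AddCommGroup M] [Module R M] (h : FactorsThroughPD R k M) :
    HasResolution (NDerived.flat R) k (ModuleCat.of R M) := by
  induction k generalizing M with
  | zero => exact .zero h.flat
  | succ k ih =>
    exact .of_exact (LinearMap.ker (Finsupp.linearCombination R (id : M → M))).subtype _
      (Submodule.injective_subtype _) (LinearMap.exact_subtype_ker_map _)
      (Finsupp.linearCombination_id_surjective R M) (flat_of_projective _) (ih (h.ker hR))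

/-- Over a left coherent ring, the weak global dimension is determined by the projective dimensions
of the finitely presented modules. -/
lemma LeftCoherent.weakGlobalDimension_lt_iff (hR : LeftCoherent R) (m : ℕ) :
    (∀ M : ModuleCat.{u} R, Module.FinitePresentation R M →
      projectiveDimension M < (((m : ℕ∞) + 1 : ℕ∞) : WithBot ℕ∞)) ↔
    weakGlobalDimension R < (m : ℕ∞) + 1 := by
  constructor
  · intro h
    have h1 : ∀ M : ModuleCat.{u} R, flatDimension M ≤ m := fun M => by
      refine iInf₂_le m (FactorsThroughPD.hasResolution hR fun A _ _ _ f => ?_)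
      have : projectiveDimension (ModuleCat.of R A) < ((m + 1 : ℕ) : WithBot ℕ∞) := h _ ‹_›
      -- Each finitely presented source already has small projective dimension, so it serves as its
      -- own intermediate module.
      exact ⟨ModuleCat.of R A, ‹_›, projectiveDimension_lt_iff.1 this, LinearMap.id, f, rfl⟩
    exact (iSup_le h1).trans_lt (by exact_mod_cast Nat.lt_succ_self m)
  · intro h M hM
    have h1 : flatDimension M < (m : ℕ∞) + 1 := (le_iSup _ M).trans_lt h
    obtain ⟨k, hk⟩ := iInf_lt_iff.1 h1
    obtain ⟨hk, hkm⟩ := iInf_lt_iff.1 hk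
    exact (projectiveDimension_lt_coe_succ_iff M m).2
      ⟨k, hkm, hR.hasProjectiveDimensionLT k M hk.hasInjectiveDimensionLT_rightDual⟩

end WeakDimension

/-! ### The criterion for `n`-exact complexes to be pure exact. -/

section DerivedEquivalences

variable (R : Type u) [Ring R] (n : ℕ∞) (β : Bound)

lemma Kn_le_Kpe_iff : Kn R n β ≤ Kpe R β ↔
    LeftCoherent R ∧ ∀ M : ModuleCat.{u} R, Module.FinitePresentation R M →
      projectiveDimension M < ((n + 1 : ℕ∞) : WithBot ℕ∞) := by
  constructor
  · exact fun h => ⟨leftCoherent_of_Kn_le_Kpe h,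
      fun M _ => projectiveDimension_lt_of_Kn_le_Kpe h M⟩
  · rintro ⟨hR, h⟩ X hX i
    obtain ⟨w, h1, h2⟩ := hX i
    refine ⟨w, h1, fun M hM => h2 M ?_⟩
    obtain ⟨k, hk, hM'⟩ := (projectiveDimension_lt_coe_succ_iff M n).1 (h M hM)
    have : Module.FinitePresentation R M := hM
    exact ⟨k, hk, hR.hasResolution k M hM'⟩

instance : (knPurSub R n β).IsClosedUnderIsomorphisms :=
  inferInstanceAs (knPurFunctor R n β).essImage.IsClosedUnderIsomorphisms

end DerivedEquivalences

end NDerived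

open NDerived
theorem theorem5p4 (R : Type u) [Ring R] (n : ℕ∞) (β : Bound) :
    (∃ (F : VerdierQuotient (knPurSub R n β) ⥤ Dn R n β) (_ : F.CommShift ℤ),
      IsTriangulatedEquivalence F ∧
        Nonempty (verdierFunctor (knPurSub R n β) ⋙ F ≅ purToN R n β)) ∧
    [LeftCoherent R ∧ ∀ M : ModuleCat.{u} R, Module.FinitePresentation R M →
        projectiveDimension M < ((n + 1 : ℕ∞) : WithBot ℕ∞),
      ∀ X : KnPur R n β, IsZero X,
      IsTriangulatedEquivalence (purToN R n β)].TFAE ∧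
    ∀ m : ℕ, n = m →
      ((LeftCoherent R ∧ ∀ M : ModuleCat.{u} R, Module.FinitePresentation R M →
        projectiveDimension M < ((n + 1 : ℕ∞) : WithBot ℕ∞)) ↔
      LeftCoherent R ∧ weakGlobalDimension R < n + 1) := by
  refine ⟨exists_verdierQuotient_equivalence (Kpe_le_Kn R n β) (knPurSub R n β)
    (essImage_verdierSub_iff (Kpe_le_Kn R n β)), ?_, ?_⟩
  -- All three conditions are compared with the inclusion `Kn ≤ Kpe`.
  · rw [← Kn_le_Kpe_iff R n β]
    tfae_have 1 ↔ 2 := (forall_isZero_verdierQuotient_iff (P := Kpe R β) (Q := Kn R n β)).symm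
    tfae_have 1 ↔ 3 := by
      rw [← isEquivalence_verdierMap_iff (Kpe_le_Kn R n β)]
      exact ⟨fun h => ⟨inferInstance, h⟩, fun h => h.2⟩
    tfae_finish
  · rintro m rfl
    exact and_congr_right fun hR => hR.weakGlobalDimension_lt_iff m
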